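/- Let $\mathbb{A}$ be an infinite set of names with decidable equality. A \emph{nominal set} is a set with an action of the group of finite permutations of $\mathbb{A}$ in which every element has a finite support; $a \# x$ means that $x$ has a finite support not containing $a$. A \emph{01-substitution set} is a nominal set $X$ with an equivariant operation $(x,a,i) \mapsto x(a:=i)$ ($a \in \mathbb{A}$, $i \in 2 = \{0,1\}$) such that $a \# x(a:=i)$; $x(a:=i)=x$ if $a \# x$; and $x(a:=i)(a':=i')=x(a':=i')(a:=i)$ if $a \neq a'$. Morphisms are equivariant maps preserving the operation. Let $f : X \to Y$ be a morphism. For $e \in 2$, an \emph{$e$-open $(A,a)$-box over $f$}, where $A \subseteq \mathbb{A}$ is finite and $a \in A$, is a pair $(u,y)$ of an element $y \in Y$ and a map $u : (A \times 2) \setminus \{(a,e)\} \to X$ such that $b \# u(b,i)$, $f(u(b,i)) = y(b:=i)$, and $u(b,i)(b':=i') = u(b',i')(b:=i)$ whenever $b \neq b'$. A \emph{filler} is an $x \in X$ with $x(b:=i)=u(b,i)$ for all $(b,i) \in (A \times 2) \setminus \{(a,e)\}$ and $f(x) = y$. A \emph{Kan filling operator} for $e$-open boxes is a choice $\Phi$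 of a filler for every $e$-open box such that $\Phi(\pi(u,y)) = \pi\,\Phi(u,y)$ for every finite permutation $\pi$, and $\Phi((u,y)(c:=i)) = \Phi(u,y)(c:=i)$ for every $(A,a)$-box $(u,y)$, $c \notin A$ and $i \in 2$. The morphism $f$ is a \emph{Kan fibration} if it admits Kan filling operators both for $1$-open and for $0$-open boxes. The factorisation $X \xrightarrow{\lambda_f} K f \xrightarrow{\rho_f} Y$ is constructed as follows. Put $K_n f = X \amalg K_n^{\uparrow} f \amalg K_n^{+} f \amalg K_n^{\downarrow} f \amalg K_n^{-} f$, where $K_n^{\uparrow} f$ is the set of $1$-open boxes over $\rho : \operatorname{colim}_{m<n} K_m f \to Y$, and $K_n^{+} f$ is the set of the $\langle a\rangle(u,y)$ (name abstraction, i.e. modulo $\alpha$-equivalence) with $(u,y)$ a $1$-open $(A,a)$-box for some $A$; $K_n^{\downarrow} f$ and $K_n^{-} f$ are defined in the same way from $0$-open boxes. The map $\rho$ is $f$ on $X$, $(u,y) \mapsto y$ on boxes, and $\langle a\rangle(u,y) \mapsto y(a:=e)$ for $e$-open boxes ($e=1$ on $K_n^+ f$ and $e = 0$ on $K_n^- f$).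 Substitution on $X$ is that of $X$. On an $e$-open $(A,a)$-box, $(u,y)(b:=i)$ is $u(b,i)$ if $b \in A$ and $(b,i) \neq (a,e)$, is $\langle a\rangle(u,y)$ if $(b,i)=(a,e)$, and is $(u(b:=i),y(b:=i))$ if $b \notin A$. For $b \neq a$, $\langle a\rangle(u,y)(b:=i)$ is $u(b,i)(a:=e)$ if $b \in A$ and $\langle a\rangle(u(b:=i),y(b:=i))$ otherwise. Finally $K f = \operatorname{colim}_n K_n f$. Let $\Delta : X \to X \times_Y X$ be the diagonal. The \emph{pre-normal forms in direction $a$} are the elements of $K\Delta$ generated inductively by: (1) every $x \in X$ with $a \# x$; (2) every $1$-open $(A,a)$-box $(u,(x_1,x_2))$ in $K\Delta$ over $(x_1,x_2)$ such that $a \# x_1$, $u(a,0)=x_1$, and $u(b,i)$ is a pre-normal form in direction $a$ for all $(b,i) \in (A\setminus\{a\})\times 2$. A \emph{normal form} is an element $z(a:=1)$ with $z$ a pre-normal form in direction $a$. The normal forms make up a 01-substitution subset $P_Y X \subseteq K\Delta$. \textbf{Theorem.} If $f : X \to Y$ is a Kan fibration, then the restriction of $\rho_\Delta : K\Delta \to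 X \times_Y X$ to $P_Y X$ is a Kan fibration; that is, it admits Kan filling operators both for $1$-open and for $0$-open boxes. -/

import Mathlib

namespace ZeroOne

open scoped Pointwise

universe u v w

set_option linter.unusedSectionVars false

/-! ### Nominal sets -/

section Basic

variable (𝔸 : Type v)

/-- The group of finite permutations of the set of names. -/
def finPerm : Subgroup (Equiv.Perm 𝔸) where
  carrier := {π | {a | π a ≠ a}.Finite}
  one_mem' := by simp
  mul_mem' := by
    intro π ρ hπ hρ
    refine (Set.Finite.union hπ hρ).subset ?_
    intro a ha
    by_contra h
    simp only [Set.mem_union, Set.mem_ofPred_eq, not_or, not_not] at h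
    exact ha (by simp [h.1, h.2])
  inv_mem' := by
    intro π hπ
    refine Set.Finite.subset hπ ?_
    intro a ha h
    exact ha (by rw [Equiv.Perm.inv_eq_iff_eq]; exact h.symm)

abbrev FinPerm := ↥(finPerm 𝔸)

/-- A nominal set: a set with an action of finite permutations, in which every element has a
finite support. -/
class NominalSet (X : Type u) extends MulAction (FinPerm 𝔸) X where
  exists_support : ∀ x : X, ∃ A : Finset 𝔸, MulAction.Supports (FinPerm 𝔸) (A : Set 𝔸) x

variable {𝔸}

/-- `Fresh a x` is the freshness relation `a # x` for a name `a`. -/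
def Fresh {X : Type u} [MulAction (FinPerm 𝔸) X] (a : 𝔸) (x : X) : Prop :=
  ∃ A : Finset 𝔸, a ∉ A ∧ MulAction.Supports (FinPerm 𝔸) (A : Set 𝔸) x

variable (𝔸)

/-- A 01-substitution set. The element `false` of `Bool` plays the role of `0` and `true` that
of `1`; `sub x a i` is `x (a := i)`. -/
class SubstSet (X : Type u) extends NominalSet 𝔸 X where
  sub : X → 𝔸 → Bool → X
  perm_sub : ∀ (π : FinPerm 𝔸) (x : X) (a : 𝔸) (i : Bool), π • sub x a i = sub (π • x) (π • a) i
  fresh_sub : ∀ (x : X) (a : 𝔸) (i : Bool), Fresh a (sub x a i)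
  sub_of_fresh : ∀ (x : X) (a : 𝔸) (i : Bool), Fresh a x → sub x a i = x
  sub_comm : ∀ (x : X) (a a' : 𝔸) (i i' : Bool), a ≠ a' →
    sub (sub x a i) a' i' = sub (sub x a' i') a i

/-- Morphisms of 01-substitution sets. -/
structure SubstHom (X : Type u) (Y : Type w) [SubstSet 𝔸 X] [SubstSet 𝔸 Y] where
  toFun : X → Y
  map_smul : ∀ (π : FinPerm 𝔸) (x : X), toFun (π • x) = π • toFun x
  map_sub : ∀ (x : X) (a : 𝔸) (i : Bool),
    toFun (SubstSet.sub x a i) = SubstSet.sub (toFun x) a i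

instance (X : Type u) (Y : Type w) [SubstSet 𝔸 X] [SubstSet 𝔸 Y] :
    CoeFun (SubstHom 𝔸 X Y) (fun _ => X → Y) := ⟨SubstHom.toFun⟩

end Basic

open SubstSet

section Lemmas

variable {𝔸 : Type v}

theorem Fresh.map {X : Type u} {Y : Type w} [MulAction (FinPerm 𝔸) X] [MulAction (FinPerm 𝔸) Y]
    {F : X → Y} (hF : ∀ (π : FinPerm 𝔸) x, F (π • x) = π • F x) {a : 𝔸} {x : X}
    (h : Fresh a x) : Fresh a (F x) := by
  obtain ⟨A, ha, hA⟩ := h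
  exact ⟨A, ha, fun π hπ => by rw [← hF, hA π hπ]⟩

theorem Fresh.of_map {X : Type u} {Y : Type w} [MulAction (FinPerm 𝔸) X]
    [MulAction (FinPerm 𝔸) Y]
    {F : X → Y} (hF : ∀ (π : FinPerm 𝔸) x, F (π • x) = π • F x) (hi : Function.Injective F)
    {a : 𝔸} {x : X} (h : Fresh a (F x)) : Fresh a x := by
  obtain ⟨A, ha, hA⟩ := h
  exact ⟨A, ha, fun π hπ => hi (by rw [hF, hA π hπ])⟩

theorem Fresh.smul {X : Type u} [MulAction (FinPerm 𝔸) X] {a : 𝔸} {x : X} (h : Fresh a x)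
    (π : FinPerm 𝔸) : Fresh (π • a) (π • x) := by
  classical
  obtain ⟨A, ha, hA⟩ := h
  refine ⟨π • A, by simpa using ha, fun ρ hρ => ?_⟩
  have := hA (π⁻¹ * ρ * π) (fun b hb => by
    have : ρ • (π • b) = π • b := hρ (by simpa using hb)
    rw [mul_smul, mul_smul, this, inv_smul_smul])
  rw [mul_smul, mul_smul, inv_smul_eq_iff] at this
  exact this

theorem Fresh.sub_ne {X : Type u} [SubstSet 𝔸 X] {a b : 𝔸} {x : X} (h : Fresh a x) (hab : a ≠ b)
    (i : Bool) : Fresh a (sub x b i) := by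
  classical
  obtain ⟨A, ha, hA⟩ := h
  refine ⟨insert b A, by simp [ha, hab], fun π hπ => ?_⟩
  rw [perm_sub, hA π (fun c hc => hπ (by simp [Finset.mem_coe.1 hc])), hπ (by simp)]

theorem Fresh.sub_any {X : Type u} [SubstSet 𝔸 X] {a : 𝔸} {x : X} (h : Fresh a x) (b : 𝔸)
    (i : Bool) : Fresh a (sub x b i) := by
  by_cases hab : a = b
  · subst hab; exact fresh_sub x a i
  · exact h.sub_ne hab i

variable [DecidableEq 𝔸]

/-- The transposition `(a b)`. -/
def nswap (a b : 𝔸) : FinPerm 𝔸 :=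
  ⟨Equiv.swap a b, (Set.toFinite {a, b}).subset (by
    intro c hc
    by_contra h
    simp only [Set.mem_insert_iff, Set.mem_singleton_iff, not_or] at h
    exact hc (Equiv.swap_apply_of_ne_of_ne h.1 h.2))⟩

theorem nswap_left (a b : 𝔸) : nswap a b • a = b := Equiv.swap_apply_left a b
theorem nswap_right (a b : 𝔸) : nswap a b • b = a := Equiv.swap_apply_right a b
theorem nswap_ne {a b c : 𝔸} (h : c ≠ a) (h' : c ≠ b) : nswap a b • c = c :=
  Equiv.swap_apply_of_ne_of_ne h h'
theorem nswap_inv (a b : 𝔸) : (nswap a b)⁻¹ = nswap a b := Subtype.ext (Equiv.swap_inv a b)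
theorem nswap_self (a : 𝔸) : nswap a a = 1 := Subtype.ext (Equiv.swap_self a)
theorem nswap_comm (a b : 𝔸) : nswap a b = nswap b a := Subtype.ext (Equiv.swap_comm a b)
theorem smul_nswap {X : Type u} [MulAction (FinPerm 𝔸) X] (π : FinPerm 𝔸) (a b : 𝔸) (x : X) :
    π • nswap a b • x = nswap (π • a) (π • b) • π • x := by
  rw [smul_smul, smul_smul]
  congr 1
  exact Subtype.ext (Equiv.mul_swap_eq_swap_mul _ _ _)

variable [Infinite 𝔸]

theorem exists_notMem (A : Finset 𝔸) : ∃ a, a ∉ A := Infinite.exists_notMem_finset A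

theorem exists_fresh {X : Type u} [NominalSet 𝔸 X] (x : X) (T : Finset 𝔸) :
    ∃ c : 𝔸, c ∉ T ∧ Fresh c x := by
  obtain ⟨A, hA⟩ := NominalSet.exists_support (𝔸 := 𝔸) x
  obtain ⟨c, hc⟩ := exists_notMem (A ∪ T)
  simp only [Finset.mem_union, not_or] at hc
  exact ⟨c, hc.2, A, hc.1, hA⟩

/-- Two names that are both fresh for `x` can be swapped without changing `x`. -/
theorem nswap_smul {X : Type u} [MulAction (FinPerm 𝔸) X] {a b : 𝔸} {x : X}
    (ha : Fresh a x) (hb : Fresh b x) : nswap a b • x = x := by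
  obtain ⟨A, ha, hA⟩ := ha
  obtain ⟨B, hb, hB⟩ := hb
  by_cases hab : a = b
  · subst hab; rw [nswap_self, one_smul]
  obtain ⟨c, hc⟩ := exists_notMem (A ∪ B ∪ {a, b})
  simp only [Finset.mem_union, Finset.mem_insert, Finset.mem_singleton, not_or] at hc
  obtain ⟨⟨hcA, hcB⟩, hca, hcb⟩ := hc
  have h1 : nswap a c • x = x := hA _ (fun d hd =>
    nswap_ne (by rintro rfl; exact ha hd) (by rintro rfl; exact hcA hd))
  have h2 : nswap b c • x = x := hB _ (fun d hd =>
    nswap_ne (by rintro rfl; exact hb hd) (by rintro rfl; exact hcB hd))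
  have := smul_nswap (nswap a c) b c x
  rw [h1, h2, h1, nswap_right, nswap_ne (Ne.symm hab) (Ne.symm hcb), nswap_comm] at this
  exact this.symm

theorem fresh_name {a b : 𝔸} : Fresh a b ↔ a ≠ b := by
  constructor
  · rintro ⟨A, ha, hA⟩ rfl
    obtain ⟨c, hc⟩ := exists_notMem (insert a A)
    simp only [Finset.mem_insert, not_or] at hc
    have := hA (nswap a c) (fun d hd =>
      nswap_ne (by rintro rfl; exact ha hd) (by rintro rfl; exact hc.2 hd))
    rw [nswap_left] at this
    exact hc.1 this
  · intro h
    exact ⟨{b}, by simpa using h, fun π hπ => hπ (by simp)⟩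

/-- `α`-equivalence on `𝔸 × N`. -/
def AlphaEq {N : Type u} [NominalSet 𝔸 N] (p q : 𝔸 × N) : Prop :=
  ∃ c : 𝔸, c ≠ p.1 ∧ Fresh c p.2 ∧ c ≠ q.1 ∧ Fresh c q.2 ∧ nswap c p.1 • p.2 = nswap c q.1 • q.2

theorem AlphaEq.any {N : Type u} [NominalSet 𝔸 N] {p q : 𝔸 × N} (h : AlphaEq p q) {d : 𝔸}
    (h1 : d ≠ p.1) (h2 : Fresh d p.2) (h3 : d ≠ q.1) (h4 : Fresh d q.2) :
    nswap d p.1 • p.2 = nswap d q.1 • q.2 := by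
  obtain ⟨c, c1, c2, c3, c4, e⟩ := h
  have key : ∀ r : 𝔸 × N, d ≠ r.1 → c ≠ r.1 → Fresh d r.2 → Fresh c r.2 →
      nswap d r.1 • r.2 = nswap d c • nswap c r.1 • r.2 := by
    intro r r1 r2 r3 r4
    rw [smul_nswap, nswap_right, nswap_ne r1.symm r2.symm, nswap_smul r3 r4]
  rw [key p h1 c1 h2 c2, key q h3 c3 h4 c4, e]

/-- `α`-equivalence as a setoid; its quotient is the name abstraction `[𝔸]N`. -/
def alphaSetoid (𝔸 : Type v) [DecidableEq 𝔸] [Infinite 𝔸] (N : Type u) [NominalSet 𝔸 N] :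
    Setoid (𝔸 × N) where
  r := AlphaEq
  iseqv := by
    refine ⟨fun p => ?_, ?_, ?_⟩
    · obtain ⟨c, hc, hc'⟩ := exists_fresh (𝔸 := 𝔸) p.2 {p.1}
      exact ⟨c, by simpa using hc, hc', by simpa using hc, hc', rfl⟩
    · rintro p q ⟨c, c1, c2, c3, c4, e⟩
      exact ⟨c, c3, c4, c1, c2, e.symm⟩
    · intro p q r hpq hqr
      obtain ⟨A, hA⟩ := NominalSet.exists_support (𝔸 := 𝔸) p.2
      obtain ⟨B, hB⟩ := NominalSet.exists_support (𝔸 := 𝔸) q.2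
      obtain ⟨c, hc, hc'⟩ := exists_fresh (𝔸 := 𝔸) r.2 (A ∪ B ∪ {p.1, q.1, r.1})
      simp only [Finset.mem_union, Finset.mem_insert, Finset.mem_singleton, not_or] at hc
      obtain ⟨⟨h1, h2⟩, h3, h4, h5⟩ := hc
      exact ⟨c, h3, ⟨A, h1, hA⟩, h5, hc',
        (hpq.any h3 ⟨A, h1, hA⟩ h4 ⟨B, h2, hB⟩).trans (hqr.any h4 ⟨B, h2, hB⟩ h5 hc')⟩

end Lemmas

/-! ### Open boxes and Kan fibrations -/

section Boxes

variable {𝔸 : Type v} [DecidableEq 𝔸] {Z : Type u} {Y : Type w} [SubstSet 𝔸 Z] [SubstSet 𝔸 Y]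

/-- An `e`-open `(A, a)`-box over `g : Z → Y`. The function `u`, defined on
`(A × 2) \ {(a, e)}`, is encoded as a partial function. -/
@[ext]
structure OpenBox (g : SubstHom 𝔸 Z Y) (e : Bool) where
  A : Finset 𝔸
  a : 𝔸
  u : 𝔸 → Bool → Option Z
  y : Y
  a_mem : a ∈ A
  dom : ∀ b i, (u b i).isSome ↔ b ∈ A ∧ (b, i) ≠ (a, e)
  fresh : ∀ b i, ∀ z ∈ u b i, Fresh b z
  adj : ∀ b i b' i', b ≠ b' → ∀ z ∈ u b i, ∀ z' ∈ u b' i', sub z b' i' = sub z' b i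
  covers : ∀ b i, ∀ z ∈ u b i, g z = sub y b i

variable {g : SubstHom 𝔸 Z Y} {e : Bool}

namespace OpenBox

theorem mem_A (B : OpenBox g e) {b i z} (h : z ∈ B.u b i) : b ∈ B.A :=
  ((B.dom b i).1 (by rw [Option.mem_def.1 h]; rfl)).1

theorem ne_ae (B : OpenBox g e) {b i z} (h : z ∈ B.u b i) : (b, i) ≠ (B.a, e) :=
  ((B.dom b i).1 (by rw [Option.mem_def.1 h]; rfl)).2

theorem eq_none (B : OpenBox g e) {b} (i) (h : b ∉ B.A) : B.u b i = none := by
  rw [← Option.not_isSome_iff_eq_none, B.dom]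
  exact fun h' => h h'.1

theorem eq_none' (B : OpenBox g e) : B.u B.a e = none := by
  rw [← Option.not_isSome_iff_eq_none, B.dom]
  exact fun h' => h'.2 rfl

theorem eq_of_none (B : OpenBox g e) {b i} (h : b ∈ B.A) (hn : B.u b i = none) :
    b = B.a ∧ i = e := by
  rw [← Option.not_isSome_iff_eq_none, B.dom] at hn
  by_contra h'
  exact hn ⟨h, fun h2 => h' (Prod.mk.inj h2)⟩

/-- The action of finite permutations on open boxes. -/
def perm (π : FinPerm 𝔸) (B : OpenBox g e) : OpenBox g e where
  A := π • B.A
  a := π • B.a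
  u b i := (B.u (π⁻¹ • b) i).map (π • ·)
  y := π • B.y
  a_mem := by simpa using B.a_mem
  dom b i := by
    rw [Option.isSome_map, B.dom, ← Finset.mem_inv_smul_finset_iff, inv_inv]
    simp [inv_smul_eq_iff]
  fresh b i z hz := by
    obtain ⟨z₀, hz₀, rfl⟩ := Option.mem_map.1 hz
    simpa using (B.fresh _ _ z₀ hz₀).smul π
  adj b i b' i' hb z hz z' hz' := by
    obtain ⟨z₀, hz₀, rfl⟩ := Option.mem_map.1 hz
    obtain ⟨z₁, hz₁, rfl⟩ := Option.mem_map.1 hz'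
    have := congrArg (π • ·) (B.adj _ _ _ _ (by simpa using hb) z₀ hz₀ z₁ hz₁)
    simpa [perm_sub] using this
  covers b i z hz := by
    obtain ⟨z₀, hz₀, rfl⟩ := Option.mem_map.1 hz
    have := congrArg (π • ·) (B.covers _ _ z₀ hz₀)
    simpa [perm_sub, g.map_smul] using this

instance : MulAction (FinPerm 𝔸) (OpenBox g e) where
  smul := perm
  one_smul B := by
    refine OpenBox.ext (one_smul _ _) (one_smul _ _) ?_ (one_smul _ _)
    funext b i
    change (B.u ((1 : FinPerm 𝔸)⁻¹ • b) i).map ((1 : FinPerm 𝔸) • ·) = _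
    simp
  mul_smul π ρ B := by
    refine OpenBox.ext (mul_smul _ _ _) (mul_smul _ _ _) ?_ (mul_smul _ _ _)
    funext b i
    change (B.u ((π * ρ)⁻¹ • b) i).map ((π * ρ) • ·) =
      ((B.u (ρ⁻¹ • π⁻¹ • b) i).map (ρ • ·)).map (π • ·)
    simp [mul_smul, Function.comp_def]

theorem smul_A (π : FinPerm 𝔸) (B : OpenBox g e) : (π • B).A = π • B.A := rfl
theorem smul_a (π : FinPerm 𝔸) (B : OpenBox g e) : (π • B).a = π • B.a := rfl
theorem smul_y (π : FinPerm 𝔸) (B : OpenBox g e) : (π • B).y = π • B.y := rfl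
theorem smul_u (π : FinPerm 𝔸) (B : OpenBox g e) (b i) :
    (π • B).u b i = (B.u (π⁻¹ • b) i).map (π • ·) := rfl
theorem smul_u' (π : FinPerm 𝔸) (B : OpenBox g e) (b i) :
    (π • B).u (π • b) i = (B.u b i).map (π • ·) := by rw [smul_u, inv_smul_smul]
theorem smul_mem_A (π : FinPerm 𝔸) (B : OpenBox g e) (b) : π • b ∈ (π • B).A ↔ b ∈ B.A := by
  rw [smul_A]; simp

theorem supports (B : OpenBox g e) (S : Finset 𝔸) (hA : B.A ⊆ S)
    (hy : MulAction.Supports (FinPerm 𝔸) (S : Set 𝔸) B.y)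
    (hu : ∀ b i, ∀ z ∈ B.u b i, MulAction.Supports (FinPerm 𝔸) (S : Set 𝔸) z) :
    MulAction.Supports (FinPerm 𝔸) (S : Set 𝔸) B := by
  intro π hπ
  have hfix : ∀ b ∈ B.A, π • b = b := fun b hb => hπ (hA hb)
  have hA' : π • B.A = B.A := by
    refine Finset.eq_of_subset_of_card_le ?_ (by simp)
    intro b hb
    obtain ⟨c, hc, rfl⟩ := Finset.mem_smul_finset.1 hb
    rw [hfix c hc]; exact hc
  refine OpenBox.ext hA' (hfix _ B.a_mem) ?_ (hy π hπ)
  funext b i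
  by_cases hb : b ∈ B.A
  · rw [smul_u, inv_smul_eq_iff.2 (hfix b hb).symm]
    cases h : B.u b i with
    | none => rfl
    | some z => exact congrArg some (hu b i z h π hπ)
  · rw [B.eq_none i hb, (π • B).eq_none i (by rw [smul_A, hA']; exact hb)]

instance : NominalSet 𝔸 (OpenBox g e) where
  exists_support B := by
    choose s hs using fun z : Z => NominalSet.exists_support (𝔸 := 𝔸) z
    obtain ⟨t, ht⟩ := NominalSet.exists_support (𝔸 := 𝔸) B.y
    let r : 𝔸 → Bool → Finset 𝔸 := fun b i => (B.u b i).elim ∅ s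
    refine ⟨B.A ∪ t ∪ B.A.biUnion (fun b => r b false ∪ r b true), B.supports _ ?_ ?_ ?_⟩
    · exact fun b hb => by simp [hb]
    · exact ht.mono (fun b hb => by simp [Finset.mem_coe.1 hb])
    · intro b i z hz
      refine (hs z).mono (fun c hc => ?_)
      have hr : c ∈ r b i := by
        simp only [r, Option.mem_def.1 hz, Option.elim_some]; exact hc
      simp only [Finset.coe_union, Finset.coe_biUnion, Set.mem_union, Set.mem_iUnion]
      refine Or.inr ⟨b, B.mem_A hz, ?_⟩
      cases i
      · exact Or.inl hr
      · exact Or.inr hr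

/-- Substitution `(u, y)(c := i)` of an open `(A, a)`-box, for `c # A`. -/
def subst (B : OpenBox g e) (c : 𝔸) (i : Bool) (hc : c ∉ B.A) : OpenBox g e where
  A := B.A
  a := B.a
  u b j := (B.u b j).map (sub · c i)
  y := sub B.y c i
  a_mem := B.a_mem
  dom b j := by rw [Option.isSome_map, B.dom]
  fresh b j z hz := by
    obtain ⟨z₀, hz₀, rfl⟩ := Option.mem_map.1 hz
    exact (B.fresh _ _ z₀ hz₀).sub_any _ _
  adj b j b' j' hb z hz z' hz' := by
    obtain ⟨z₀, hz₀, rfl⟩ := Option.mem_map.1 hz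
    obtain ⟨z₁, hz₁, rfl⟩ := Option.mem_map.1 hz'
    have h1 : c ≠ b := by rintro rfl; exact hc (B.mem_A hz₀)
    have h2 : c ≠ b' := by rintro rfl; exact hc (B.mem_A hz₁)
    rw [sub_comm _ _ _ _ _ h2, sub_comm _ _ _ _ _ h1, B.adj _ _ _ _ hb z₀ hz₀ z₁ hz₁]
  covers b j z hz := by
    obtain ⟨z₀, hz₀, rfl⟩ := Option.mem_map.1 hz
    have h1 : c ≠ b := by rintro rfl; exact hc (B.mem_A hz₀)
    rw [g.map_sub, B.covers _ _ z₀ hz₀, sub_comm _ _ _ _ _ h1]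

theorem subst_A (B : OpenBox g e) (c i hc) : (B.subst c i hc).A = B.A := rfl
theorem subst_a (B : OpenBox g e) (c i hc) : (B.subst c i hc).a = B.a := rfl
theorem subst_y (B : OpenBox g e) (c i hc) : (B.subst c i hc).y = sub B.y c i := rfl
theorem subst_u (B : OpenBox g e) (c i hc) (b j) :
    (B.subst c i hc).u b j = (B.u b j).map (sub · c i) := rfl

end OpenBox

/-- A Kan filling operator for `e`-open boxes over `g`. -/
structure KanFillingOperator (g : SubstHom 𝔸 Z Y) (e : Bool) where
  fill : OpenBox g e → Z
  sub_fill : ∀ (B : OpenBox g e) (b : 𝔸) (i : Bool), ∀ z ∈ B.u b i, sub (fill B) b i = z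
  map_fill : ∀ B : OpenBox g e, g (fill B) = B.y
  fill_smul : ∀ (π : FinPerm 𝔸) (B : OpenBox g e), fill (π • B) = π • fill B
  fill_subst : ∀ (B : OpenBox g e) (c : 𝔸) (i : Bool) (hc : c ∉ B.A),
    fill (B.subst c i hc) = sub (fill B) c i

/-- A Kan fibration is a morphism that admits Kan filling operators both for `1`-open and for
`0`-open boxes. -/
def IsKanFibration (g : SubstHom 𝔸 Z Y) : Prop :=
  Nonempty (KanFillingOperator g true) ∧ Nonempty (KanFillingOperator g false)

end Boxes


/-! ### The free fibration on a morphism -/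

section Comp

variable {𝔸 : Type v} [DecidableEq 𝔸] [Infinite 𝔸]

theorem fresh_of_nswap {X : Type u} [MulAction (FinPerm 𝔸) X] {c d : 𝔸} {x : X}
    (hd : Fresh d x) (h : nswap d c • x = x) : Fresh c x := by
  have := hd.smul (nswap d c)
  rwa [nswap_left, h] at this

variable {Z : Type u} {Y : Type w} [SubstSet 𝔸 Z] [SubstSet 𝔸 Y]
  {g : SubstHom 𝔸 Z Y} {e : Bool}

namespace OpenBox

theorem notMem_of_fresh {B : OpenBox g e} {c : 𝔸} (h : Fresh c B) : c ∉ B.A := by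
  intro hc
  obtain ⟨d, hd, hd'⟩ := exists_fresh (𝔸 := 𝔸) B B.A
  have h1 := (smul_mem_A (nswap c d) B c).2 hc
  rw [nswap_smul h hd', nswap_left] at h1
  exact hd h1

theorem fresh_iff {B : OpenBox g e} {c : 𝔸} :
    Fresh c B ↔ c ∉ B.A ∧ Fresh c B.y ∧ ∀ b i, ∀ z ∈ B.u b i, Fresh c z := by
  have mp : ∀ {c : 𝔸}, Fresh c B → c ∉ B.A ∧ Fresh c B.y ∧ ∀ b i, ∀ z ∈ B.u b i, Fresh c z := by
    intro c h
    have hA := notMem_of_fresh h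
    refine ⟨hA, h.map (F := OpenBox.y) smul_y, fun b i z hz => ?_⟩
    have hcb : c ≠ b := by rintro rfl; exact hA (B.mem_A hz)
    obtain ⟨d, hd, hd'⟩ := exists_fresh (𝔸 := 𝔸) (B, z).1 {b, c}
    obtain ⟨S, hcS, hS⟩ := h
    refine ⟨insert b S, by simp [hcb, hcS], fun π hπ => ?_⟩
    have h1 : π • B = B := hS π (fun a ha => hπ (by simp [Finset.mem_coe.1 ha]))
    have h2 := smul_u' π B b i
    rw [h1, hπ (by simp : b ∈ _), Option.mem_def.1 hz] at h2
    exact (Option.some.inj h2).symm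
  refine ⟨mp, fun ⟨hA, hy, hu⟩ => ?_⟩
  obtain ⟨d, hd, hd'⟩ := exists_fresh (𝔸 := 𝔸) B ∅
  obtain ⟨dA, dy, du⟩ := mp hd'
  refine fresh_of_nswap hd' ?_
  have hfix : ∀ b ∈ B.A, nswap d c • b = b := fun b hb =>
    nswap_ne (by rintro rfl; exact dA hb) (by rintro rfl; exact hA hb)
  have hA' : nswap d c • B.A = B.A := by
    refine Finset.eq_of_subset_of_card_le ?_ (by simp)
    intro b hb
    obtain ⟨c, hc, rfl⟩ := Finset.mem_smul_finset.1 hb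
    rw [hfix c hc]; exact hc
  refine OpenBox.ext hA' (hfix _ B.a_mem) ?_ (nswap_smul dy hy)
  funext b i
  by_cases hb : b ∈ B.A
  · rw [smul_u, inv_smul_eq_iff.2 (hfix b hb).symm]
    cases h : B.u b i with
    | none => rfl
    | some z => exact congrArg some (nswap_smul (du b i z h) (hu b i z h))
  · rw [B.eq_none i hb, (nswap d c • B).eq_none i (by rw [smul_A, hA']; exact hb)]

theorem fresh_subst (B : OpenBox g e) (c i hc) : Fresh c (B.subst c i hc) := by
  refine fresh_iff.2 ⟨hc, fresh_sub _ _ _, fun b j z hz => ?_⟩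
  obtain ⟨z, -, rfl⟩ := Option.mem_map.1 hz
  exact fresh_sub _ _ _

theorem subst_of_fresh {B : OpenBox g e} {c : 𝔸} (i) (hc) (h : Fresh c B) :
    B.subst c i hc = B := by
  obtain ⟨hA, hy, hu⟩ := fresh_iff.1 h
  refine OpenBox.ext rfl rfl ?_ (sub_of_fresh _ _ _ hy)
  funext b j
  rw [subst_u]
  cases h : B.u b j with
  | none => rfl
  | some z => exact congrArg some (sub_of_fresh _ _ _ (hu b j z h))

theorem smul_subst (π : FinPerm 𝔸) (B : OpenBox g e) (c i hc) :
    π • B.subst c i hc = (π • B).subst (π • c) i (by rwa [smul_mem_A]) := by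
  refine OpenBox.ext rfl rfl ?_ (perm_sub _ _ _ _)
  funext b j
  rw [smul_u, subst_u, subst_u, smul_u]
  simp [Function.comp_def, perm_sub]

theorem subst_comm (B : OpenBox g e) (c c' : 𝔸) (i i' : Bool) (hc hc') (h : c ≠ c') :
    (B.subst c i hc).subst c' i' hc' = (B.subst c' i' hc').subst c i hc := by
  refine OpenBox.ext rfl rfl ?_ (sub_comm _ _ _ _ _ h)
  funext b j
  change ((B.u b j).map (sub · c i)).map (sub · c' i') =
    ((B.u b j).map (sub · c' i')).map (sub · c i)
  rw [Option.map_map, Option.map_map]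
  exact congrArg (fun F => Option.map F (B.u b j)) (funext fun z => sub_comm z _ _ i i' h)

/-- The image of an open box under a morphism over `Y`. -/
def map {Z' : Type*} [SubstSet 𝔸 Z'] {g' : SubstHom 𝔸 Z' Y} (h : SubstHom 𝔸 Z Z')
    (hg : ∀ z, g' (h z) = g z) (B : OpenBox g e) : OpenBox g' e where
  A := B.A
  a := B.a
  u b i := (B.u b i).map h
  y := B.y
  a_mem := B.a_mem
  dom b j := by rw [Option.isSome_map, B.dom]
  fresh b j z hz := by
    obtain ⟨z₀, hz₀, rfl⟩ := Option.mem_map.1 hz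
    exact (B.fresh _ _ z₀ hz₀).map h.map_smul
  adj b j b' j' hb z hz z' hz' := by
    obtain ⟨z₀, hz₀, rfl⟩ := Option.mem_map.1 hz
    obtain ⟨z₁, hz₁, rfl⟩ := Option.mem_map.1 hz'
    rw [← h.map_sub, ← h.map_sub, B.adj _ _ _ _ hb z₀ hz₀ z₁ hz₁]
  covers b j z hz := by
    obtain ⟨z₀, hz₀, rfl⟩ := Option.mem_map.1 hz
    rw [hg, B.covers _ _ z₀ hz₀]

section Map

variable {Z' : Type*} [SubstSet 𝔸 Z'] {g' : SubstHom 𝔸 Z' Y} (h : SubstHom 𝔸 Z Z')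
    (hg : ∀ z, g' (h z) = g z) (B : OpenBox g e)

theorem map_A : (B.map h hg).A = B.A := rfl
theorem map_a : (B.map h hg).a = B.a := rfl
theorem map_y : (B.map h hg).y = B.y := rfl
theorem map_u (b i) : (B.map h hg).u b i = (B.u b i).map h := rfl

theorem map_smul (π : FinPerm 𝔸) : (π • B).map h hg = π • B.map h hg := by
  refine OpenBox.ext rfl rfl ?_ rfl
  funext b i
  simp [map_u, smul_u, Function.comp_def, h.map_smul]

theorem map_subst (c i hc) : (B.subst c i hc).map h hg = (B.map h hg).subst c i hc := by
  refine OpenBox.ext rfl rfl ?_ rfl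
  funext b j
  change ((B.u b j).map (sub · c i)).map h = ((B.u b j).map h).map (sub · c i)
  simp only [Option.map_map, Function.comp_def, h.map_sub]

end Map

end OpenBox

/-- `α`-equivalence of the pairs `(a, (u, y))` where `(u, y)` is an `e`-open `(A, a)`-box. -/
def compSetoid (g : SubstHom 𝔸 Z Y) (e : Bool) : Setoid (OpenBox g e) :=
  (alphaSetoid 𝔸 (OpenBox g e)).comap (fun B => (B.a, B))

/-- The set of the `⟨a⟩(u, y)` where `(u, y)` is an `e`-open `(A, a)`-box for some `A`, that is,
the image in the name abstraction on open boxes of the set of pairs `(a, (u, y))` with `(u, y)` an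
`(A, a)`-box. -/
def CompBox (g : SubstHom 𝔸 Z Y) (e : Bool) := Quotient (compSetoid g e)

namespace CompBox

/-- The element `⟨a⟩(u, y)`. -/
def mk (B : OpenBox g e) : CompBox g e := Quotient.mk _ B

theorem sound {B B' : OpenBox g e} (h : AlphaEq (B.a, B) (B'.a, B')) : mk B = mk B' :=
  Quotient.sound (s := compSetoid g e) h

theorem mk_eq {B B' : OpenBox g e} : mk B = mk B' ↔ AlphaEq (B.a, B) (B'.a, B') :=
  ⟨fun h => Quotient.exact (s := compSetoid g e) h, sound⟩

theorem ne_a {B : OpenBox g e} {c : 𝔸} (h : Fresh c B) : c ≠ B.a := by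
  rintro rfl
  exact OpenBox.notMem_of_fresh h B.a_mem

theorem fresh_a {B : OpenBox g e} {c : 𝔸} (h : Fresh c B) : Fresh B.a (nswap c B.a • B) := by
  have := h.smul (nswap c B.a)
  rwa [nswap_left] at this

/-- To define a function on `⟨a⟩(u, y)` it suffices that renaming `a` to all but finitely many of
the fresh names does not change the value. -/
theorem respects {W : Type*} (F : OpenBox g e → W) (T : Finset 𝔸)
    (hF : ∀ (B : OpenBox g e) (c : 𝔸), c ∉ T → Fresh c B → F (nswap c B.a • B) = F B)
    {B B' : OpenBox g e} (h : AlphaEq (B.a, B) (B'.a, B')) : F B = F B' := by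
  obtain ⟨S, hS⟩ := NominalSet.exists_support (𝔸 := 𝔸) B
  obtain ⟨c, hc, hc'⟩ := exists_fresh (𝔸 := 𝔸) B' (S ∪ T)
  simp only [Finset.mem_union, not_or] at hc
  have hB : Fresh c B := ⟨S, hc.1, hS⟩
  have := h.any (ne_a hB) hB (ne_a hc') hc'
  rw [← hF B c hc.2 hB, ← hF B' c hc.2 hc', this]

theorem nswap_alpha {B : OpenBox g e} {c : 𝔸} (h : Fresh c B) :
    AlphaEq ((nswap c B.a • B).a, nswap c B.a • B) (B.a, B) := by
  obtain ⟨d, hd, hd'⟩ := exists_fresh (𝔸 := 𝔸) B {c}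
  have hdc : d ≠ c := by simpa using hd
  have hda := ne_a hd'
  have h1 : Fresh d (nswap c B.a • B) := by
    have := hd'.smul (nswap c B.a)
    rwa [nswap_ne hdc hda] at this
  refine ⟨d, ne_a h1, h1, hda, hd', ?_⟩
  dsimp only
  rw [OpenBox.smul_a, nswap_right, smul_nswap, nswap_right,
    nswap_ne (ne_a hd').symm (ne_a h).symm, nswap_smul hd' h]

theorem mk_nswap {B : OpenBox g e} {c : 𝔸} (h : Fresh c B) : mk (nswap c B.a • B) = mk B :=
  sound (nswap_alpha h)

theorem alpha_smul (π : FinPerm 𝔸) {B B' : OpenBox g e} (h : AlphaEq (B.a, B) (B'.a, B')) :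
    AlphaEq ((π • B).a, π • B) ((π • B').a, π • B') := by
  obtain ⟨c, h1, h2, h3, h4, h5⟩ := h
  refine ⟨π • c, by simpa [OpenBox.smul_a] using h1, h2.smul π,
    by simpa [OpenBox.smul_a] using h3, h4.smul π, ?_⟩
  have := congrArg (π • ·) h5
  simpa only [smul_nswap, OpenBox.smul_a] using this

instance : MulAction (FinPerm 𝔸) (CompBox g e) where
  smul π := Quotient.map (sa := compSetoid g e) (sb := compSetoid g e) (π • ·)
    (fun _ _ h => alpha_smul π h)
  one_smul q := Quotient.inductionOn q (fun B => congrArg mk (one_smul _ B))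
  mul_smul π ρ q := Quotient.inductionOn q (fun B => congrArg mk (mul_smul π ρ B))

theorem smul_mk (π : FinPerm 𝔸) (B : OpenBox g e) : π • mk B = mk (π • B) := rfl

instance : NominalSet 𝔸 (CompBox g e) where
  exists_support q := Quotient.inductionOn q (fun B => by
    obtain ⟨S, hS⟩ := NominalSet.exists_support (𝔸 := 𝔸) B
    exact ⟨S, fun π hπ => congrArg mk (hS π hπ)⟩)

theorem fresh_mk {B : OpenBox g e} {c : 𝔸} (h : Fresh c B) : Fresh c (mk B) :=
  h.map (F := mk) (fun _ _ => rfl)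

/-- Every element is of the form `⟨a⟩(u, y)` with `a` outside a given finite set. -/
theorem exists_rep (q : CompBox g e) (T : Finset 𝔸) : ∃ B : OpenBox g e, B.a ∉ T ∧ q = mk B := by
  obtain ⟨B, rfl⟩ := Quotient.exists_rep q
  obtain ⟨c, hc, hc'⟩ := exists_fresh (𝔸 := 𝔸) B T
  refine ⟨nswap c B.a • B, ?_, (mk_nswap hc').symm⟩
  rwa [OpenBox.smul_a, nswap_right]

theorem fresh_a_mk (B : OpenBox g e) : Fresh B.a (mk B) := by
  obtain ⟨c, -, hc⟩ := exists_fresh (𝔸 := 𝔸) B ∅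
  rw [← mk_nswap hc]
  exact fresh_mk (fresh_a hc)

/-- A name that is fresh for the class is fresh for some representative. -/
theorem exists_rep_of_fresh {q : CompBox g e} {b : 𝔸} (h : Fresh b q) :
    ∃ B : OpenBox g e, Fresh b B ∧ q = mk B := by
  obtain ⟨B, rfl⟩ := Quotient.exists_rep q
  obtain ⟨c, -, hc⟩ := exists_fresh (𝔸 := 𝔸) B ∅
  refine ⟨nswap c b • B, ?_, ?_⟩
  · have := hc.smul (nswap c b)
    rwa [nswap_left] at this
  · rw [← smul_mk]
    exact (nswap_smul (fresh_mk hc) h).symm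

end CompBox

end Comp

section Step

variable {𝔸 : Type v} [DecidableEq 𝔸] [Infinite 𝔸]
  {X : Type*} {Y : Type*} {Z : Type*} [SubstSet 𝔸 X] [SubstSet 𝔸 Y] [SubstSet 𝔸 Z]

/-- The nominal set `X ⨿ K↑ ⨿ K⁺ ⨿ K↓ ⨿ K⁻` of one stage of the construction, where `g : Z → Y` is
the previous stage. `fill true`, `comp true`, `fill false`, `comp false` are the components
`K↑`, `K⁺`, `K↓` and `K⁻`. -/
inductive KStep (X : Type*) (g : SubstHom 𝔸 Z Y) where
  | base (x : X) : KStep X g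
  | fill (e : Bool) (B : OpenBox g e) : KStep X g
  | comp (e : Bool) (q : CompBox g e) : KStep X g

variable {g : SubstHom 𝔸 Z Y} {e : Bool}

theorem OpenBox.cases (B : OpenBox g e) (b : 𝔸) (i : Bool) :
    (∃ z, z ∈ B.u b i) ∨ (b = B.a ∧ i = e) ∨ b ∉ B.A := by
  by_cases hb : b ∈ B.A
  · cases h : B.u b i with
    | none => exact Or.inr (Or.inl (B.eq_of_none hb h))
    | some z => exact Or.inl ⟨z, rfl⟩
  · exact Or.inr (Or.inr hb)

theorem OpenBox.cases' (B : OpenBox g e) (b : 𝔸) (i : Bool) :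
    (b ≠ B.a ∧ ∃ z, z ∈ B.u b i) ∨ b = B.a ∨ b ∉ B.A := by
  rcases B.cases b i with h | h | h
  · by_cases hb : b = B.a
    · exact Or.inr (Or.inl hb)
    · exact Or.inl ⟨hb, h⟩
  · exact Or.inr (Or.inl h.1)
  · exact Or.inr (Or.inr h)

namespace KStep

instance : MulAction (FinPerm 𝔸) (KStep X g) where
  smul π k := match k with
    | base x => base (π • x)
    | fill e B => fill e (π • B)
    | comp e q => comp e (π • q)
  one_smul k := by
    cases k with
    | base x => exact congrArg base (one_smul _ x)
    | fill e B => exact congrArg (fill e) (one_smul _ B)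
    | comp e q => exact congrArg (comp e) (one_smul _ q)
  mul_smul π ρ k := by
    cases k with
    | base x => exact congrArg base (mul_smul π ρ x)
    | fill e B => exact congrArg (fill e) (mul_smul π ρ B)
    | comp e q => exact congrArg (comp e) (mul_smul π ρ q)

theorem smul_base (π : FinPerm 𝔸) (x : X) : π • (base x : KStep X g) = base (π • x) := rfl
theorem smul_fill (π : FinPerm 𝔸) (B : OpenBox g e) :
    π • (fill e B : KStep X g) = fill e (π • B) := rfl
theorem smul_comp (π : FinPerm 𝔸) (q : CompBox g e) :
    π • (comp e q : KStep X g) = comp e (π • q) := rfl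

instance : NominalSet 𝔸 (KStep X g) where
  exists_support k := by
    cases k with
    | base x =>
      obtain ⟨S, hS⟩ := NominalSet.exists_support (𝔸 := 𝔸) x
      exact ⟨S, fun π hπ => congrArg base (hS π hπ)⟩
    | fill e B =>
      obtain ⟨S, hS⟩ := NominalSet.exists_support (𝔸 := 𝔸) B
      exact ⟨S, fun π hπ => congrArg (fill e) (hS π hπ)⟩
    | comp e q =>
      obtain ⟨S, hS⟩ := NominalSet.exists_support (𝔸 := 𝔸) q
      exact ⟨S, fun π hπ => congrArg (comp e) (hS π hπ)⟩

/-- The map from a stage to `Y`. -/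
def rho (f : X → Y) : KStep X g → Y
  | base x => f x
  | fill _ B => B.y
  | comp e q => Quotient.lift (s := compSetoid g e) (fun B => sub B.y B.a e)
      (fun _ _ h => CompBox.respects (fun B : OpenBox g e => sub B.y B.a e) ∅ (by
        intro B c _ hc
        have h1 : Fresh c B.y := (OpenBox.fresh_iff.1 hc).2.1
        have h2 : nswap c B.a • sub B.y B.a e = sub B.y B.a e :=
          nswap_smul (h1.sub_any _ _) (fresh_sub _ _ _)
        rw [OpenBox.smul_y, OpenBox.smul_a, ← perm_sub, h2]) h) q

theorem rho_smul (f : SubstHom 𝔸 X Y) (π : FinPerm 𝔸) (k : KStep X g) :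
    rho f (π • k) = π • rho f k := by
  cases k with
  | base x => exact f.map_smul π x
  | fill e B => rfl
  | comp e q => exact Quotient.inductionOn q (fun B => (perm_sub π B.y B.a e).symm)

/-- Substitution on elements `(u, y)`. -/
def fillSub (ι : Z → KStep X g) (B : OpenBox g e) (b : 𝔸) (i : Bool) : KStep X g :=
  if h : b ∈ B.A then (B.u b i).elim (comp e (CompBox.mk B)) ι else fill e (B.subst b i h)

/-- Substitution on elements `⟨a⟩(u, y)`. -/
def compSub (ι : Z → KStep X g) (B : OpenBox g e) (b : 𝔸) (i : Bool) : KStep X g :=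
  if b = B.a then comp e (CompBox.mk B)
  else if h : b ∈ B.A then
    (B.u b i).elim (comp e (CompBox.mk B)) (fun z => ι (sub z B.a e))
  else comp e (CompBox.mk (B.subst b i h))

section SubLemmas

variable (ι : Z → KStep X g) {B : OpenBox g e} {b : 𝔸} {i : Bool}

theorem fillSub_mem {z : Z} (hz : z ∈ B.u b i) : fillSub ι B b i = ι z := by
  rw [fillSub, dif_pos (B.mem_A hz), Option.mem_def.1 hz, Option.elim_some]

theorem fillSub_ae : fillSub ι B B.a e = comp e (CompBox.mk B) := by
  rw [fillSub, dif_pos B.a_mem, B.eq_none', Option.elim_none]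

theorem fillSub_notMem (h : b ∉ B.A) : fillSub ι B b i = fill e (B.subst b i h) := by
  rw [fillSub, dif_neg h]

theorem compSub_a : compSub ι B B.a i = comp e (CompBox.mk B) := by
  rw [compSub, if_pos rfl]

theorem compSub_mem (hb : b ≠ B.a) {z : Z} (hz : z ∈ B.u b i) :
    compSub ι B b i = ι (sub z B.a e) := by
  rw [compSub, if_neg hb, dif_pos (B.mem_A hz), Option.mem_def.1 hz, Option.elim_some]

theorem compSub_notMem (h : b ∉ B.A) : compSub ι B b i = comp e (CompBox.mk (B.subst b i h)) := by
  have hne : b ≠ B.a := by rintro rfl; exact h B.a_mem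
  rw [compSub, if_neg hne, dif_neg h]

variable (B b i) in
theorem smul_fillSub (hι : ∀ (π : FinPerm 𝔸) z, ι (π • z) = π • ι z) (π : FinPerm 𝔸) :
    π • fillSub ι B b i = fillSub ι (π • B) (π • b) i := by
  rcases B.cases b i with ⟨z, hz⟩ | ⟨rfl, rfl⟩ | hb
  · rw [fillSub_mem ι hz, fillSub_mem ι (z := π • z), hι]
    rw [OpenBox.smul_u', Option.mem_def.1 hz]; rfl
  · rw [fillSub_ae, ← OpenBox.smul_a, fillSub_ae]; rfl
  · rw [fillSub_notMem ι hb, fillSub_notMem ι (by rwa [OpenBox.smul_mem_A]), smul_fill,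
      OpenBox.smul_subst]

variable (B b i) in
theorem smul_compSub (hι : ∀ (π : FinPerm 𝔸) z, ι (π • z) = π • ι z) (π : FinPerm 𝔸) :
    π • compSub ι B b i = compSub ι (π • B) (π • b) i := by
  rcases B.cases' b i with ⟨hb, z, hz⟩ | rfl | hb
  · rw [compSub_mem ι hb hz, compSub_mem ι (z := π • z), ← hι, perm_sub]; rfl
    · simpa [OpenBox.smul_a] using hb
    · rw [OpenBox.smul_u', Option.mem_def.1 hz]; rfl
  · rw [compSub_a, ← OpenBox.smul_a, compSub_a]; rfl
  · rw [compSub_notMem ι hb, compSub_notMem ι (by rwa [OpenBox.smul_mem_A]), smul_comp,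
      CompBox.smul_mk, OpenBox.smul_subst]

theorem compSub_of_fresh (h : Fresh b B) : compSub ι B b i = comp e (CompBox.mk B) := by
  rw [compSub_notMem ι (OpenBox.notMem_of_fresh h), OpenBox.subst_of_fresh _ _ h]

variable (B b i) in
theorem fresh_compSub (hι : ∀ (π : FinPerm 𝔸) z, ι (π • z) = π • ι z) :
    Fresh b (compSub ι B b i) := by
  have hc : ∀ {c : 𝔸} {q : CompBox g e}, Fresh c q → Fresh c (comp e q : KStep X g) :=
    fun h => h.map (F := comp e) (fun _ _ => rfl)
  rcases B.cases' b i with ⟨hb, z, hz⟩ | rfl | hb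
  · rw [compSub_mem ι hb hz]
    exact ((B.fresh _ _ _ hz).sub_any _ _).map hι
  · rw [compSub_a]
    exact hc (CompBox.fresh_a_mk B)
  · rw [compSub_notMem ι hb]
    exact hc (CompBox.fresh_mk (OpenBox.fresh_subst _ _ _ _))

theorem fresh_a_compSub (hι : ∀ (π : FinPerm 𝔸) z, ι (π • z) = π • ι z) :
    Fresh B.a (compSub ι B b i) := by
  have hc : ∀ {c : 𝔸} {q : CompBox g e}, Fresh c q → Fresh c (comp e q : KStep X g) :=
    fun h => h.map (F := comp e) (fun _ _ => rfl)
  rcases B.cases' b i with ⟨hb, z, hz⟩ | rfl | hb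
  · rw [compSub_mem ι hb hz]
    exact (fresh_sub _ _ _).map hι
  · rw [compSub_a]
    exact hc (CompBox.fresh_a_mk B)
  · rw [compSub_notMem ι hb]
    exact hc (CompBox.fresh_a_mk (B.subst b i hb))

theorem fresh_compSub' (hι : ∀ (π : FinPerm 𝔸) z, ι (π • z) = π • ι z) {c : 𝔸} (hcb : c ≠ b)
    (h : Fresh c B) : Fresh c (compSub ι B b i) := by
  obtain ⟨S, hc, hS⟩ := h
  refine ⟨insert b S, by simp [hcb, hc], fun π hπ => ?_⟩
  rw [smul_compSub ι B b i hι, hπ (by simp),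
    hS π (fun a ha => hπ (by simp [Finset.mem_coe.1 ha]))]

theorem compSub_respects (hι : ∀ (π : FinPerm 𝔸) z, ι (π • z) = π • ι z) (b : 𝔸) (i : Bool)
    {B B' : OpenBox g e} (h : AlphaEq (B.a, B) (B'.a, B')) :
    compSub ι B b i = compSub ι B' b i := by
  refine CompBox.respects (fun B => compSub ι B b i) {b} ?_ h
  intro B c hcT hc
  have hcb : c ≠ b := by simpa using hcT
  by_cases hb : b = B.a
  · subst hb
    rw [compSub_of_fresh ι (CompBox.fresh_a hc), compSub_a, CompBox.mk_nswap hc]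
  · have h1 := smul_compSub ι B b i hι (nswap c B.a)
    rw [nswap_ne hcb.symm hb] at h1
    rw [← h1]
    exact nswap_smul (fresh_compSub' ι hι hcb hc) (fresh_a_compSub ι hι)

end SubLemmas

/-- The substitution operation of a stage, where `ι` is the inclusion of the previous stage. -/
def stepSub (ι : Z → KStep X g) (hι : ∀ (π : FinPerm 𝔸) z, ι (π • z) = π • ι z)
    (k : KStep X g) (b : 𝔸) (i : Bool) : KStep X g :=
  match k with
  | base x => base (sub x b i)
  | fill _ B => fillSub ι B b i
  | comp e q => Quotient.lift (s := compSetoid g e) (fun B => compSub ι B b i)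
      (fun _ _ h => compSub_respects ι hι b i h) q

theorem stepSub_comp (ι : Z → KStep X g) (hι) (B : OpenBox g e) (b : 𝔸) (i : Bool) :
    stepSub ι hι (comp e (CompBox.mk B)) b i = compSub ι B b i := rfl

theorem stepSub_fill (ι : Z → KStep X g) (hι) (B : OpenBox g e) (b : 𝔸) (i : Bool) :
    stepSub ι hι (fill e B) b i = fillSub ι B b i := rfl

/-- Functoriality of the stages in the previous stage. -/
def map {Z' : Type*} [SubstSet 𝔸 Z'] {g' : SubstHom 𝔸 Z' Y} (h : SubstHom 𝔸 Z Z')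
    (hg : ∀ z, g' (h z) = g z) : KStep X g → KStep X g'
  | base x => base x
  | fill e B => fill e (B.map h hg)
  | comp e q => comp e (Quotient.map (sa := compSetoid g e) (sb := compSetoid g' e)
      (OpenBox.map h hg) (by
        rintro B B' ⟨c, h1, h2, h3, h4, h5⟩
        refine ⟨c, h1, h2.map (F := OpenBox.map h hg) (fun π B => OpenBox.map_smul h hg B π), h3,
          h4.map (F := OpenBox.map h hg) (fun π B => OpenBox.map_smul h hg B π), ?_⟩
        have := congrArg (OpenBox.map h hg) h5
        rw [OpenBox.map_smul, OpenBox.map_smul] at this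
        exact this) q)

end KStep

end Step

/-- A stage of the construction for `f : X → Y`: a 01-substitution set `Z` over `Y` with its
inclusion `ι` into the next stage. -/
structure Stage {𝔸 : Type v} [DecidableEq 𝔸] [Infinite 𝔸] {X : Type u} {Y : Type w}
    [SubstSet 𝔸 X] [SubstSet 𝔸 Y] (f : SubstHom 𝔸 X Y) where
  Z : Type (max u v w)
  [inst : SubstSet 𝔸 Z]
  ρ : SubstHom 𝔸 Z Y
  ι : Z → KStep X ρ
  ι_smul : ∀ (π : FinPerm 𝔸) (z : Z), ι (π • z) = π • ι z
  ι_sub : ∀ (z : Z) (b : 𝔸) (i : Bool), ι (sub z b i) = KStep.stepSub ι ι_smul (ι z) b i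
  ρ_ι : ∀ z : Z, KStep.rho f (ι z) = ρ z

namespace Stage

attribute [instance] Stage.inst

variable {𝔸 : Type v} [DecidableEq 𝔸] [Infinite 𝔸] {X : Type u} {Y : Type w}
    [SubstSet 𝔸 X] [SubstSet 𝔸 Y] {f : SubstHom 𝔸 X Y} (s : Stage f)

open KStep in
theorem step_comm {e : Bool} (B : OpenBox s.ρ e) (b b' : 𝔸) (i i' : Bool) (h : b ≠ b')
    (hb : b ∈ B.A) :
    stepSub s.ι s.ι_smul (fillSub s.ι B b i) b' i' =
      stepSub s.ι s.ι_smul (fillSub s.ι B b' i') b i := by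
  rcases B.cases b i with ⟨z, hz⟩ | ⟨rfl, rfl⟩ | hb
  · rcases B.cases b' i' with ⟨z', hz'⟩ | ⟨rfl, rfl⟩ | hb'
    · rw [fillSub_mem _ hz, fillSub_mem _ hz', ← s.ι_sub, ← s.ι_sub,
        B.adj _ _ _ _ h z hz z' hz']
    · rw [fillSub_mem _ hz, fillSub_ae, ← s.ι_sub, stepSub_comp, compSub_mem _ h hz]
    · rw [fillSub_mem _ hz, fillSub_notMem _ hb', ← s.ι_sub, stepSub_fill,
        fillSub_mem s.ι (z := sub z b' i')]
      rw [OpenBox.subst_u, Option.mem_def.1 hz]; rfl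
  · rcases B.cases b' i' with ⟨z', hz'⟩ | ⟨rfl, rfl⟩ | hb'
    · rw [fillSub_mem _ hz', fillSub_ae, ← s.ι_sub, stepSub_comp, compSub_mem _ h.symm hz']
    · exact absurd rfl h
    · rw [fillSub_ae, fillSub_notMem _ hb', stepSub_comp, stepSub_fill, compSub_notMem _ hb']
      exact (fillSub_ae s.ι (B := B.subst b' i' hb')).symm
  · contradiction

open KStep in
instance stepSubst : SubstSet 𝔸 (KStep X s.ρ) where
  sub := stepSub s.ι s.ι_smul
  perm_sub π k b i := by
    cases k with
    | base x => exact congrArg base (perm_sub π x b i)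
    | fill e B => exact smul_fillSub s.ι B b i s.ι_smul π
    | comp e q => exact Quotient.inductionOn q (fun B => smul_compSub s.ι B b i s.ι_smul π)
  fresh_sub k b i := by
    cases k with
    | base x => exact (fresh_sub x b i).map (F := base) (fun _ _ => rfl)
    | fill e B =>
      change Fresh b (fillSub s.ι B b i)
      rcases B.cases b i with ⟨z, hz⟩ | ⟨rfl, rfl⟩ | hb
      · rw [fillSub_mem _ hz]; exact (B.fresh _ _ _ hz).map s.ι_smul
      · rw [fillSub_ae]
        exact (CompBox.fresh_a_mk B).map (F := comp i) (fun _ _ => rfl)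
      · rw [fillSub_notMem _ hb]
        exact (OpenBox.fresh_subst B _ _ _).map (F := fill e) (fun _ _ => rfl)
    | comp e q => exact Quotient.inductionOn q (fun B => fresh_compSub s.ι B b i s.ι_smul)
  sub_of_fresh k b i h := by
    cases k with
    | base x =>
      exact congrArg base (sub_of_fresh x b i (h.of_map (F := base) (fun _ _ => rfl)
        (fun _ _ h => KStep.base.inj h)))
    | fill e B =>
      have hB : Fresh b B := h.of_map (F := fill e) (fun _ _ => rfl)
        (fun _ _ h => eq_of_heq (KStep.fill.inj h).2)
      change fillSub s.ι B b i = _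
      rw [fillSub_notMem _ (OpenBox.notMem_of_fresh hB), OpenBox.subst_of_fresh _ _ hB]
    | comp e q =>
      have hq : Fresh b q := h.of_map (F := comp e) (fun _ _ => rfl)
        (fun _ _ h => eq_of_heq (KStep.comp.inj h).2)
      obtain ⟨B, hB, rfl⟩ := CompBox.exists_rep_of_fresh hq
      exact compSub_of_fresh s.ι hB
  sub_comm k b b' i i' h := by
    cases k with
    | base x => exact congrArg base (sub_comm x b b' i i' h)
    | fill e B =>
      change stepSub s.ι s.ι_smul (fillSub s.ι B b i) b' i' =
        stepSub s.ι s.ι_smul (fillSub s.ι B b' i') b i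
      by_cases hb : b ∈ B.A
      · exact s.step_comm B b b' i i' h hb
      by_cases hb' : b' ∈ B.A
      · exact (s.step_comm B b' b i' i h.symm hb').symm
      rw [fillSub_notMem _ hb, fillSub_notMem _ hb', stepSub_fill, stepSub_fill,
        fillSub_notMem s.ι (B := B.subst b i hb) hb', fillSub_notMem s.ι (B := B.subst b' i' hb') hb]
      exact congrArg (fill e) (OpenBox.subst_comm B b b' i i' hb hb' h)
    | comp e q =>
      obtain ⟨B, hB, rfl⟩ := CompBox.exists_rep q {b, b'}
      simp only [Finset.mem_insert, Finset.mem_singleton, not_or] at hB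
      change stepSub s.ι s.ι_smul (compSub s.ι B b i) b' i' =
        stepSub s.ι s.ι_smul (compSub s.ι B b' i') b i
      have key : ∀ (b b' : 𝔸) (i i' : Bool), b ≠ b' → B.a ≠ b → B.a ≠ b' → b ∈ B.A →
          stepSub s.ι s.ι_smul (compSub s.ι B b i) b' i' =
            stepSub s.ι s.ι_smul (compSub s.ι B b' i') b i := by
        intro b b' i i' h hab hab' hb
        rcases B.cases' b i with ⟨hba, z, hz⟩ | rfl | hb
        · rcases B.cases' b' i' with ⟨hba', z', hz'⟩ | rfl | hb'
          · rw [compSub_mem _ hba hz, compSub_mem _ hba' hz', ← s.ι_sub, ← s.ι_sub,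
              sub_comm _ _ _ _ _ hab, sub_comm _ _ _ _ _ hab', B.adj _ _ _ _ h z hz z' hz']
          · exact absurd rfl hab'
          · rw [compSub_mem _ hba hz, compSub_notMem _ hb', ← s.ι_sub, stepSub_comp,
              compSub_mem s.ι (B := B.subst b' i' hb') (z := sub z b' i') hba,
              sub_comm _ _ _ _ _ hab']; rfl
            rw [OpenBox.subst_u, Option.mem_def.1 hz]; rfl
        · exact absurd rfl hab
        · contradiction
      by_cases hb : b ∈ B.A
      · exact key b b' i i' h hB.1 hB.2 hb
      by_cases hb' : b' ∈ B.A
      · exact (key b' b i' i h.symm hB.2 hB.1 hb').symm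
      rw [compSub_notMem _ hb, compSub_notMem _ hb', stepSub_comp, stepSub_comp,
        compSub_notMem s.ι (B := B.subst b i hb) hb', compSub_notMem s.ι (B := B.subst b' i' hb') hb]
      exact congrArg (fun B => comp e (CompBox.mk B))
        (OpenBox.subst_comm B b b' i i' hb hb' h)

theorem sub_def (k : KStep X s.ρ) (b i) : sub k b i = KStep.stepSub s.ι s.ι_smul k b i := rfl

/-- The inclusion of a stage in the next one as a morphism. -/
def ιHom : SubstHom 𝔸 s.Z (KStep X s.ρ) := ⟨s.ι, s.ι_smul, s.ι_sub⟩

open KStep in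
/-- The morphism from the next stage to `Y`. -/
def ρNext : SubstHom 𝔸 (KStep X s.ρ) Y where
  toFun := rho f
  map_smul := rho_smul f
  map_sub k b i := by
    cases k with
    | base x => exact f.map_sub x b i
    | fill e B =>
      change rho f (fillSub s.ι B b i) = sub B.y b i
      rcases B.cases b i with ⟨z, hz⟩ | ⟨rfl, rfl⟩ | hb
      · rw [fillSub_mem _ hz, s.ρ_ι, B.covers _ _ _ hz]
      · rw [fillSub_ae]; rfl
      · rw [fillSub_notMem _ hb]; rfl
    | comp e q =>
      refine Quotient.inductionOn q (fun B => ?_)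
      change rho f (compSub s.ι B b i) = sub (sub B.y B.a e) b i
      rcases B.cases' b i with ⟨hb, z, hz⟩ | rfl | hb
      · rw [compSub_mem _ hb hz, s.ρ_ι, s.ρ.map_sub, B.covers _ _ _ hz, sub_comm _ _ _ _ _ hb]
      · rw [compSub_a, sub_of_fresh (sub B.y B.a e) _ _ (fresh_sub _ _ _)]; rfl
      · have hb' : B.a ≠ b := fun h => hb (h ▸ B.a_mem)
        rw [compSub_notMem _ hb, sub_comm _ _ _ _ _ hb']; rfl

theorem ρNext_ι (z : s.Z) : s.ρNext (s.ιHom z) = s.ρ z := s.ρ_ι z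

open KStep in
/-- The next stage. -/
def next : Stage f where
  Z := KStep X s.ρ
  ρ := s.ρNext
  ι := KStep.map s.ιHom s.ρNext_ι
  ι_smul π k := by
    cases k with
    | base x => rfl
    | fill e B => exact congrArg (KStep.fill e) (OpenBox.map_smul s.ιHom s.ρNext_ι B π)
    | comp e q =>
      exact Quotient.inductionOn q (fun B => congrArg (fun B => KStep.comp e (CompBox.mk B))
        (OpenBox.map_smul s.ιHom s.ρNext_ι B π))
  ι_sub k b i := by
    have hmem : ∀ {e : Bool} {B : OpenBox s.ρ e} {z}, z ∈ B.u b i →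
        s.ι z ∈ (B.map s.ιHom s.ρNext_ι : OpenBox s.ρNext e).u b i := by
      intro e B z hz
      rw [OpenBox.map_u, Option.mem_def.1 hz]; rfl
    cases k with
    | base x => rfl
    | fill e B =>
      change KStep.map s.ιHom s.ρNext_ι (fillSub s.ι B b i) =
        fillSub (KStep.map s.ιHom s.ρNext_ι) (B.map s.ιHom s.ρNext_ι) b i
      rcases B.cases b i with ⟨z, hz⟩ | ⟨rfl, rfl⟩ | hb
      · rw [fillSub_mem _ hz, fillSub_mem _ (hmem hz)]
      · rw [fillSub_ae]
        exact (fillSub_ae (KStep.map s.ιHom s.ρNext_ι) (B := B.map s.ιHom s.ρNext_ι)).symm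
      · rw [fillSub_notMem _ hb, fillSub_notMem _ (B := B.map s.ιHom s.ρNext_ι) hb]
        exact congrArg (fill e) (OpenBox.map_subst s.ιHom s.ρNext_ι B b i hb)
    | comp e q =>
      refine Quotient.inductionOn q (fun B => ?_)
      change KStep.map s.ιHom s.ρNext_ι (compSub s.ι B b i) =
        compSub (KStep.map s.ιHom s.ρNext_ι) (B.map s.ιHom s.ρNext_ι) b i
      rcases B.cases' b i with ⟨hb, z, hz⟩ | rfl | hb
      · rw [compSub_mem _ hb hz, compSub_mem _ (B := B.map s.ιHom s.ρNext_ι) hb (hmem hz)]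
        exact congrArg (KStep.map s.ιHom s.ρNext_ι) (s.ι_sub _ _ _)
      · rw [compSub_a]
        exact (compSub_a (KStep.map s.ιHom s.ρNext_ι) (B := B.map s.ιHom s.ρNext_ι)).symm
      · rw [compSub_notMem _ hb, compSub_notMem _ (B := B.map s.ιHom s.ρNext_ι) hb]
        exact congrArg (fun B => comp e (CompBox.mk B)) (OpenBox.map_subst s.ιHom s.ρNext_ι B b i hb)
  ρ_ι k := by
    cases k with
    | base x => rfl
    | fill e B => rfl
    | comp e q => exact Quotient.inductionOn q (fun B => rfl)

end Stage

section FreeFibration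

variable {𝔸 : Type v} [DecidableEq 𝔸] [Infinite 𝔸] {X : Type u} {Y : Type w}
    [SubstSet 𝔸 X] [SubstSet 𝔸 Y]

/-- The empty 01-substitution set. -/
instance emptySubst : SubstSet 𝔸 PEmpty.{u + 1} where
  smul _ x := x
  one_smul x := x.elim
  mul_smul _ _ x := x.elim
  exists_support x := x.elim
  sub x _ _ := x
  perm_sub _ x := x.elim
  fresh_sub x := x.elim
  sub_of_fresh x := x.elim
  sub_comm x := x.elim

/-- The empty stage. -/
def Stage.zero (f : SubstHom 𝔸 X Y) : Stage f where
  Z := PEmpty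
  ρ := ⟨fun x => x.elim, fun _ x => x.elim, fun x => x.elim⟩
  ι x := x.elim
  ι_smul _ x := x.elim
  ι_sub x := x.elim
  ρ_ι x := x.elim

/-- `(chain f n).Z` is the colimit of the `K_m f` for `m < n`: it is empty for `n = 0` and is
`K_n f` for `n + 1`. -/
def chain (f : SubstHom 𝔸 X Y) : ℕ → Stage f
  | 0 => Stage.zero f
  | n + 1 => (chain f n).next

/-- The relation generating the colimit of the chain. -/
inductive ChainRel (f : SubstHom 𝔸 X Y) :
    (Σ n, (chain f n).Z) → (Σ n, (chain f n).Z) → Prop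
  | step (n : ℕ) (z : (chain f n).Z) : ChainRel f ⟨n, z⟩ ⟨n + 1, (chain f n).ι z⟩

/-- The object `K f` of the factorisation `X → K f → Y`: the colimit of the chain. -/
def K (f : SubstHom 𝔸 X Y) := Quot (ChainRel f)

namespace K

variable {f : SubstHom 𝔸 X Y}

/-- The element of `K f` given by an element of a stage. -/
def mk (n : ℕ) (z : (chain f n).Z) : K f := Quot.mk _ ⟨n, z⟩

theorem mk_ι (n : ℕ) (z : (chain f n).Z) : (mk (n + 1) ((chain f n).ι z) : K f) = mk n z :=
  (Quot.sound (ChainRel.step n z)).symm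

@[elab_as_elim]
theorem ind {p : K f → Prop} (h : ∀ n z, p (mk n z)) (k : K f) : p k := by
  obtain ⟨⟨n, z⟩, rfl⟩ := Quot.exists_rep k
  exact h n z

instance : MulAction (FinPerm 𝔸) (K f) where
  smul π := Quot.lift (fun p => mk p.1 (π • p.2)) (by
    rintro _ _ ⟨n, z⟩
    exact (mk_ι n (π • z)).symm.trans (congrArg (mk (n + 1)) ((chain f n).ι_smul π z)))
  one_smul k := by
    induction k using ind with | h n z => exact congrArg (mk n) (one_smul _ z)
  mul_smul π ρ k := by
    induction k using ind with | h n z => exact congrArg (mk n) (mul_smul π ρ z)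

theorem smul_mk (π : FinPerm 𝔸) (n : ℕ) (z : (chain f n).Z) :
    π • (mk n z : K f) = mk n (π • z) := rfl

theorem fresh_mk {n : ℕ} {z : (chain f n).Z} {a : 𝔸} (h : Fresh a z) : Fresh a (mk n z : K f) :=
  h.map (F := mk n) (fun _ _ => rfl)

instance : NominalSet 𝔸 (K f) where
  exists_support k := by
    induction k using ind with | h n z =>
    obtain ⟨S, hS⟩ := NominalSet.exists_support (𝔸 := 𝔸) z
    exact ⟨S, fun π hπ => congrArg (mk n) (hS π hπ)⟩

instance : SubstSet 𝔸 (K f) where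
  sub k b i := Quot.lift (fun p => mk p.1 (sub p.2 b i)) (by
    rintro _ _ ⟨n, z⟩
    exact (mk_ι n (sub z b i)).symm.trans (congrArg (mk (n + 1)) ((chain f n).ι_sub z b i))) k
  perm_sub π k b i := by
    induction k using ind with | h n z => exact congrArg (mk n) (perm_sub π z b i)
  fresh_sub k b i := by
    induction k using ind with | h n z => exact fresh_mk (fresh_sub z b i)
  sub_of_fresh k b i h := by
    induction k using ind with | h n z =>
    obtain ⟨c, -, hc⟩ := exists_fresh (𝔸 := 𝔸) z ∅
    have h1 : (mk n z : K f) = mk n (nswap c b • z) := (nswap_smul (fresh_mk hc) h).symm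
    have h2 : Fresh b (nswap c b • z) := by
      have := hc.smul (nswap c b)
      rwa [nswap_left] at this
    rw [h1]
    exact congrArg (mk n) (sub_of_fresh _ b i h2)
  sub_comm k b b' i i' h := by
    induction k using ind with | h n z => exact congrArg (mk n) (sub_comm z b b' i i' h)

theorem sub_mk (n : ℕ) (z : (chain f n).Z) (b : 𝔸) (i : Bool) :
    sub (mk n z : K f) b i = mk n (sub z b i) := rfl

/-- The copy of `X` in `K f`. -/
def base (x : X) : K f := mk 1 (KStep.base x : KStep X (chain f 0).ρ)

/-- The element `(u, y)` of `K f` for an `e`-open box `(u, y)`. -/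
def fill (n : ℕ) {e : Bool} (B : OpenBox (chain f n).ρ e) : K f :=
  mk (n + 1) (KStep.fill e B : KStep X (chain f n).ρ)

theorem sub_fill_mem (n : ℕ) {e : Bool} (B : OpenBox (chain f n).ρ e) {b : 𝔸} {i : Bool}
    {z : (chain f n).Z} (hz : z ∈ B.u b i) : sub (fill n B : K f) b i = mk n z :=
  (congrArg (mk (n + 1)) (KStep.fillSub_mem (chain f n).ι hz)).trans (mk_ι n z)

theorem sub_fill_notMem (n : ℕ) {e : Bool} (B : OpenBox (chain f n).ρ e) {b : 𝔸} {i : Bool}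
    (hb : b ∉ B.A) : sub (fill n B : K f) b i = fill n (B.subst b i hb) :=
  congrArg (mk (n + 1)) (KStep.fillSub_notMem (chain f n).ι hb)

theorem smul_fill (π : FinPerm 𝔸) (n : ℕ) {e : Bool} (B : OpenBox (chain f n).ρ e) :
    π • (fill n B : K f) = fill n (π • B) := rfl

variable (f)

/-- The morphism `λ_f : X → K f`. -/
def lam : SubstHom 𝔸 X (K f) := ⟨base, fun _ _ => rfl, fun _ _ _ => rfl⟩

/-- The morphism `ρ_f : K f → Y`. -/
def rho : SubstHom 𝔸 (K f) Y where
  toFun := Quot.lift (fun p => (chain f p.1).ρ p.2) (by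
    rintro _ _ ⟨n, z⟩
    exact ((chain f n).ρ_ι z).symm)
  map_smul π k := by
    induction k using ind with | h n z => exact (chain f n).ρ.map_smul π z
  map_sub k b i := by
    induction k using ind with | h n z => exact (chain f n).ρ.map_sub z b i

theorem rho_fill (n : ℕ) {e : Bool} (B : OpenBox (chain f n).ρ e) :
    rho f (fill n B) = B.y := rfl

theorem rho_lam (x : X) : rho f (lam f x) = f x := rfl

end K

end FreeFibration

/-! ### The path object -/

section PathObject

variable {𝔸 : Type v} {X : Type u} {Y : Type w} [SubstSet 𝔸 X] [SubstSet 𝔸 Y]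

/-- A subset that is closed under permutations and substitutions is a 01-substitution set. -/
@[reducible] def substSubset (p : X → Prop) (hπ : ∀ (π : FinPerm 𝔸) x, p x → p (π • x))
    (hs : ∀ x (a : 𝔸) i, p x → p (sub x a i)) : SubstSet 𝔸 {x // p x} :=
  letI act : MulAction (FinPerm 𝔸) {x // p x} :=
    { smul := fun π x => ⟨π • x.1, hπ π x.1 x.2⟩
      one_smul := fun x => Subtype.ext (one_smul _ x.1)
      mul_smul := fun π ρ x => Subtype.ext (mul_smul π ρ x.1) }
  have hval : ∀ (π : FinPerm 𝔸) (x : {x // p x}), (π • x).1 = π • x.1 := fun _ _ => rfl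
  { act with
    exists_support := fun x => by
      obtain ⟨S, hS⟩ := NominalSet.exists_support (𝔸 := 𝔸) x.1
      exact ⟨S, fun π h => Subtype.ext (hS π h)⟩
    sub := fun x a i => ⟨sub x.1 a i, hs x.1 a i x.2⟩
    perm_sub := fun π x a i => Subtype.ext (perm_sub π x.1 a i)
    fresh_sub := fun x a i => Fresh.of_map (F := Subtype.val) hval Subtype.val_injective
      (fresh_sub x.1 a i)
    sub_of_fresh := fun x a i h => Subtype.ext
      (sub_of_fresh x.1 a i (h.map (F := Subtype.val) hval))
    sub_comm := fun x a a' i i' h => Subtype.ext (sub_comm x.1 a a' i i' h) }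

/-- Products of 01-substitution sets. -/
instance prodSubst : SubstSet 𝔸 (X × Y) where
  exists_support x := by
    classical
    obtain ⟨S, hS⟩ := NominalSet.exists_support (𝔸 := 𝔸) x.1
    obtain ⟨T, hT⟩ := NominalSet.exists_support (𝔸 := 𝔸) x.2
    exact ⟨S ∪ T, fun π h => Prod.ext
      (hS π (fun a ha => h (by simp [Finset.mem_coe.1 ha])))
      (hT π (fun a ha => h (by simp [Finset.mem_coe.1 ha])))⟩
  sub x a i := (sub x.1 a i, sub x.2 a i)
  perm_sub π x a i := Prod.ext (perm_sub π x.1 a i) (perm_sub π x.2 a i)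
  fresh_sub x a i := by
    classical
    obtain ⟨S, ha, hS⟩ := fresh_sub x.1 a i
    obtain ⟨T, ha', hT⟩ := fresh_sub x.2 a i
    exact ⟨S ∪ T, by simp [ha, ha'], fun π h => Prod.ext
      (hS π (fun a ha => h (by simp [Finset.mem_coe.1 ha])))
      (hT π (fun a ha => h (by simp [Finset.mem_coe.1 ha])))⟩
  sub_of_fresh x a i h := Prod.ext
    (sub_of_fresh x.1 a i (h.map (F := Prod.fst) (fun _ _ => rfl)))
    (sub_of_fresh x.2 a i (h.map (F := Prod.snd) (fun _ _ => rfl)))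
  sub_comm x a a' i i' h := Prod.ext (sub_comm x.1 a a' i i' h) (sub_comm x.2 a a' i i' h)

/-- The fibre product `X ×_Y X`. -/
def FibreSquare (f : SubstHom 𝔸 X Y) := {p : X × X // f p.1 = f p.2}

instance (f : SubstHom 𝔸 X Y) : SubstSet 𝔸 (FibreSquare f) :=
  substSubset (fun p : X × X => f p.1 = f p.2)
    (fun π p h => by
      change f (π • p.1) = f (π • p.2)
      rw [f.map_smul, f.map_smul, h])
    (fun p a i h => by
      change f (sub p.1 a i) = f (sub p.2 a i)
      rw [f.map_sub, f.map_sub, h])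

/-- The diagonal map `Δ : X → X ×_Y X`. -/
def diag (f : SubstHom 𝔸 X Y) : SubstHom 𝔸 X (FibreSquare f) :=
  ⟨fun x => ⟨(x, x), rfl⟩, fun _ _ => rfl, fun _ _ _ => rfl⟩

variable [DecidableEq 𝔸] [Infinite 𝔸] (f : SubstHom 𝔸 X Y)

/-- The pre-normal forms in direction `a` in `K Δ`. In the second clause, the open box `B` over
`(x₁, x₂) = B.y` has direction `a`, and `x₁` is `B.y.1.1`. -/
inductive PreNormal (a : 𝔸) : K (diag f) → Prop
  | base (x : X) : Fresh a x → PreNormal a (K.lam (diag f) x)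
  | fill (n : ℕ) (B : OpenBox (chain (diag f) n).ρ true) :
      B.a = a → Fresh a B.y.1.1 →
      (∀ z ∈ B.u a false, K.mk n z = K.lam (diag f) B.y.1.1) →
      (∀ b i, b ≠ a → ∀ z ∈ B.u b i, PreNormal a (K.mk n z)) →
      PreNormal a (K.fill n B)

variable {f}

theorem PreNormal.smul {a : 𝔸} {k : K (diag f)} (h : PreNormal f a k) (π : FinPerm 𝔸) :
    PreNormal f (π • a) (π • k) := by
  induction h with
  | base x hx => exact PreNormal.base (f := f) (π • x) (hx.smul π)
  | fill n B ha hf h0 hs ih =>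
    refine PreNormal.fill n (π • B) (by rw [OpenBox.smul_a, ha]) (hf.smul π) ?_ ?_
    · intro z hz
      rw [OpenBox.smul_u'] at hz
      obtain ⟨z₀, hz₀, rfl⟩ := Option.mem_map.1 hz
      exact congrArg (π • ·) (h0 z₀ hz₀)
    · intro b i hb z hz
      obtain ⟨z₀, hz₀, rfl⟩ := Option.mem_map.1 hz
      exact ih _ i (by rwa [ne_eq, inv_smul_eq_iff]) z₀ hz₀

theorem PreNormal.sub {a : 𝔸} {k : K (diag f)} (h : PreNormal f a k) (c : 𝔸) (j : Bool)
    (hc : c ≠ a) : PreNormal f a (sub k c j) := by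
  induction h with
  | base x hx => exact PreNormal.base (f := f) (SubstSet.sub x c j) (hx.sub_any c j)
  | fill n B ha hf h0 hs ih =>
    rcases B.cases c j with ⟨z, hz⟩ | ⟨h1, -⟩ | hcA
    · rw [K.sub_fill_mem n B hz]
      exact hs c j hc z hz
    · exact absurd (h1.trans ha) hc
    · rw [K.sub_fill_notMem n B hcA]
      refine PreNormal.fill n (B.subst c j hcA) ha (hf.sub_any c j) ?_ ?_
      · intro z hz
        obtain ⟨z₀, hz₀, rfl⟩ := Option.mem_map.1 hz
        exact congrArg (SubstSet.sub · c j) (h0 z₀ hz₀)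
      · intro b i hb z hz
        obtain ⟨z₀, hz₀, rfl⟩ := Option.mem_map.1 hz
        exact ih b i hb z₀ hz₀

variable (f)

/-- The normal forms in `K Δ`: the elements `z (a := 1)` with `z` a pre-normal form in
direction `a`. -/
def IsNormal (k : K (diag f)) : Prop :=
  ∃ (a : 𝔸) (z : K (diag f)), PreNormal f a z ∧ k = sub z a true

/-- The path object `P_Y X`, the set of normal forms in `K Δ`. -/
def PathObj := {k : K (diag f) // IsNormal f k}

instance : SubstSet 𝔸 (PathObj f) :=
  substSubset (IsNormal f)
    (by
      rintro π _ ⟨a, z, hz, rfl⟩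
      exact ⟨π • a, π • z, hz.smul π, perm_sub _ _ _ _⟩)
    (by
      rintro _ c j ⟨a, z, hz, rfl⟩
      by_cases hc : a = c
      · subst hc
        exact ⟨a, z, hz, sub_of_fresh _ _ _ (fresh_sub _ _ _)⟩
      · exact ⟨a, sub z c j, hz.sub c j (Ne.symm hc), sub_comm _ _ _ _ _ hc⟩)

/-- The restriction of `ρ_Δ : K Δ → X ×_Y X` to `P_Y X`. -/
def PathObj.proj : SubstHom 𝔸 (PathObj f) (FibreSquare f) where
  toFun k := K.rho (diag f) k.1
  map_smul π k := (K.rho (diag f)).map_smul π k.1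
  map_sub k a i := (K.rho (diag f)).map_sub k.1 a i

end PathObject

end ZeroOne

namespace ZeroOne

open scoped Pointwise
open SubstSet

universe u v w

set_option linter.unusedSectionVars false

/-! ### Stages embed into the colimit -/

section Injectivity

variable {𝔸 : Type v} [DecidableEq 𝔸]

/-! A normal form is the composite `z(a := 1)` of a formal box `z` in direction `a`. Since `K Δ` is
generated freely, `z` can be recovered from the composite once the fresh name `a` is fixed
(`PreNormal.eq_of_sub_true_eq`). The recovered form `pre a k` therefore commutes with permutations
and with substitutions for names other than `a`, although it is obtained by choice. If `z` lies over
`(x₁, p)`, then `p` is a path in `X` along `a`, in a fibre of `f`, from `x₁` to the second component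
of the normal form.

Let `B` be an `e`-open box of normal forms over `(x₁, x₂)`, and let `a` be fresh for `B`. The paths
underlying the faces of `B`, with `x₁` and `x₂` as the two faces in direction `a`, form an `e`-open
box in `X` over `f` (`pathBox`). The given filling operator for `f` yields a path `p` from `x₁` to
`x₂`, and the filler of `B` will be the composite of a pre-normal box over `(x₁, p)` whose sides are
the `pre a k`.

One side of that box is still missing, namely the one at `(B.a, e)`. It needs no further filling in
`X`: it is itself a formal pre-normal box (`lid`), over `(x₁, p)(B.a := e)`, with sides the
restrictions of the `pre a k` to `B.a := e`. The formal boxes are `1`-open in direction `a` whatever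
`e` is, so the same construction serves both values of `e`.

Every step is equivariant and commutes with substitution for names away from `a` and `B.A`.
Equivariance also makes the result independent of `a` (`fillAt_eq`), which gives a uniform filling
operator. -/

theorem OpenBox.map_injective {Z : Type*} {Z' : Type*} {Y : Type*} [SubstSet 𝔸 Z] [SubstSet 𝔸 Z']
    [SubstSet 𝔸 Y] {g : SubstHom 𝔸 Z Y} {g' : SubstHom 𝔸 Z' Y} {e : Bool} (h : SubstHom 𝔸 Z Z')
    (hg : ∀ z, g' (h z) = g z) (hi : Function.Injective h) :
    Function.Injective (OpenBox.map h hg : OpenBox g e → OpenBox g' e) := by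
  intro B B' hB
  refine OpenBox.ext (congrArg OpenBox.A hB :) (congrArg OpenBox.a hB :) ?_
    (congrArg OpenBox.y hB :)
  funext b i
  exact Option.map_injective hi (congrFun (congrFun (congrArg OpenBox.u hB) b) i)

/-- An open box whose faces lie in the image of an injective morphism comes from an open box in
the domain. -/
theorem OpenBox.exists_map_eq {Z : Type*} {Z' : Type*} {Y : Type*} [SubstSet 𝔸 Z] [SubstSet 𝔸 Z']
    [SubstSet 𝔸 Y] {g : SubstHom 𝔸 Z Y} {g' : SubstHom 𝔸 Z' Y} {e : Bool} (h : SubstHom 𝔸 Z Z')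
    (hg : ∀ z, g' (h z) = g z) (hi : Function.Injective h) (B : OpenBox g' e)
    (hB : ∀ b i, ∀ z' ∈ B.u b i, ∃ z, h z = z') : ∃ B₀ : OpenBox g e, B₀.map h hg = B := by
  have hex : ∀ b i, ∃ o : Option Z, o.map h = B.u b i := by
    intro b i
    cases hz : B.u b i with
    | none => exact ⟨none, rfl⟩
    | some z' =>
      obtain ⟨z, rfl⟩ := hB b i z' hz
      exact ⟨some z, rfl⟩
  choose u hu using hex
  have hmem : ∀ {b i z}, z ∈ u b i → h z ∈ B.u b i := by
    intro b i z hz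
    rw [← hu, Option.mem_def.1 hz]; rfl
  refine ⟨⟨B.A, B.a, u, B.y, B.a_mem, ?_, ?_, ?_, ?_⟩, ?_⟩
  · intro b i
    rw [← B.dom, ← hu, Option.isSome_map]
  · intro b i z hz
    exact (B.fresh b i _ (hmem hz)).of_map h.map_smul hi
  · intro b i b' i' hb z hz z' hz'
    apply hi
    rw [h.map_sub, h.map_sub, B.adj b i b' i' hb _ (hmem hz) _ (hmem hz')]
  · intro b i z hz
    rw [← hg, B.covers b i _ (hmem hz)]
  · exact OpenBox.ext rfl rfl (funext fun b => funext fun i => hu b i) rfl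

variable [Infinite 𝔸] {X : Type u} {Y : Type w} [SubstSet 𝔸 X] [SubstSet 𝔸 Y]

/-- Two open boxes in the same direction `a` with the same name abstraction are equal. -/
theorem CompBox.mk_injective {Z : Type*} [SubstSet 𝔸 Z] {g : SubstHom 𝔸 Z Y} {e : Bool}
    {B B' : OpenBox g e} (ha : B.a = B'.a) (h : CompBox.mk B = CompBox.mk B') : B = B' := by
  obtain ⟨c, -, -, -, -, h5⟩ := CompBox.mk_eq.1 h
  dsimp only at h5
  -- With equal directions, the two transpositions in the `α`-equivalence are the same group element
  -- and cancel.
  rw [← ha] at h5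
  exact smul_left_cancel _ h5

/-- The constructors are disjoint and injective. On name abstractions, the name witnessing
`α`-equivalence of the images also works upstairs, because freshness and equality are reflected by
an injective equivariant map. -/
theorem KStep.map_injective {Z : Type*} {Z' : Type*} [SubstSet 𝔸 Z] [SubstSet 𝔸 Z']
    {g : SubstHom 𝔸 Z Y} {g' : SubstHom 𝔸 Z' Y} (h : SubstHom 𝔸 Z Z')
    (hg : ∀ z, g' (h z) = g z) (hi : Function.Injective h) :
    Function.Injective (KStep.map h hg : KStep X g → KStep X g') := by
  intro k k' hk
  cases k with
  | base x => cases k' with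
    | base x' => exact congrArg _ (KStep.base.inj hk)
    | fill e' B' => cases hk
    | comp e' q' => cases hk
  | fill e B => cases k' with
    | base x' => cases hk
    | fill e' B' =>
      obtain ⟨rfl, h2⟩ := KStep.fill.inj hk
      exact congrArg _ (OpenBox.map_injective h hg hi (eq_of_heq h2))
    | comp e' q' => cases hk
  | comp e q => cases k' with
    | base x' => cases hk
    | fill e' B' => cases hk
    | comp e' q' =>
      obtain ⟨rfl, h2⟩ := KStep.comp.inj hk
      revert hk h2
      refine Quotient.inductionOn₂ q q' (fun B B' hk h2 => ?_)
      obtain ⟨c, h1, h2, h3, h4, h5⟩ := Quotient.exact (s := compSetoid g' e) (eq_of_heq h2)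
      refine congrArg (KStep.comp e) (Quotient.sound (s := compSetoid g e) ?_)
      have hinj := OpenBox.map_injective (e := e) h hg hi
      refine ⟨c, h1, h2.of_map (fun π B => OpenBox.map_smul h hg B π) hinj, h3,
        h4.of_map (fun π B => OpenBox.map_smul h hg B π) hinj, hinj ?_⟩
      rw [OpenBox.map_smul, OpenBox.map_smul]
      exact h5

variable (f : SubstHom 𝔸 X Y)

theorem chain_ι_injective (n : ℕ) : Function.Injective (chain f n).ι := by
  induction n with
  | zero => exact fun x => x.elim
  | succ n ih => exact KStep.map_injective (chain f n).ιHom (chain f n).ρNext_ι ih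

namespace K

/-- The shift by one stage. -/
def shift (p : Σ n, (chain f n).Z) : Σ n, (chain f n).Z := ⟨p.1 + 1, (chain f p.1).ι p.2⟩

theorem shift_injective : Function.Injective (shift f) := by
  rintro ⟨n, z⟩ ⟨m, z'⟩ h
  obtain rfl : n = m := Nat.succ_injective (congrArg Sigma.fst h)
  exact congrArg _ (chain_ι_injective f n (eq_of_heq (Sigma.mk.inj h).2))

theorem shift_iterate_fst (k : ℕ) (p : Σ n, (chain f n).Z) : ((shift f)^[k] p).1 = p.1 + k := by
  induction k generalizing p with
  | zero => rfl
  | succ k ih =>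
    rw [Function.iterate_succ_apply, ih]
    simp only [shift]
    omega

/-- Having a common shift is an equivalence relation that contains the generating relation of the
colimit. -/
theorem exists_shift_eq {p q : Σ n, (chain f n).Z}
    (h : (Quot.mk (ChainRel f) p : K f) = Quot.mk _ q) :
    ∃ k l, (shift f)^[k] p = (shift f)^[l] q := by
  have := Quot.eqvGen_exact h
  clear h
  induction this with
  | rel p q h =>
    obtain ⟨n, z⟩ := h
    exact ⟨1, 0, rfl⟩
  | refl p => exact ⟨0, 0, rfl⟩
  | symm p q _ ih =>
    obtain ⟨k, l, h⟩ := ih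
    exact ⟨l, k, h.symm⟩
  | trans p q r _ _ ih ih' =>
    obtain ⟨k, l, h⟩ := ih
    obtain ⟨k', l', h'⟩ := ih'
    -- Shift the first equality by `k'` and the second by `l`; they meet in the `(l + k')`-fold
    -- shift of `q`.
    refine ⟨k' + k, l + l', ?_⟩
    rw [Function.iterate_add_apply, h, ← Function.iterate_add_apply, Nat.add_comm k' l,
      Function.iterate_add_apply, h', ← Function.iterate_add_apply]

/-- Two elements of one stage with a common shift must be shifted equally often, as the index shows;
iterated shifts are injective. -/
theorem mk_injective (n : ℕ) : Function.Injective (mk n : (chain f n).Z → K f) := by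
  intro z z' h
  obtain ⟨k, l, hkl⟩ := exists_shift_eq f h
  have h1 := congrArg Sigma.fst hkl
  rw [shift_iterate_fst, shift_iterate_fst] at h1
  obtain rfl : k = l := Nat.add_left_cancel h1
  exact eq_of_heq (Sigma.mk.inj ((shift_injective f).iterate k hkl)).2

/-! ### Open boxes over the colimit and their formal fillers -/

variable {f}

theorem exists_mk_of_le {n m : ℕ} (h : n ≤ m) (z : (chain f n).Z) :
    ∃ z', (mk m z' : K f) = mk n z := by
  induction m, h using Nat.le_induction with
  | base => exact ⟨z, rfl⟩
  | succ m _ ih =>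
    obtain ⟨z', hz'⟩ := ih
    exact ⟨(chain f m).ι z', (mk_ι m z').trans hz'⟩

variable (f) in
/-- The inclusion of a stage in the colimit. -/
def mkHom (n : ℕ) : SubstHom 𝔸 (chain f n).Z (K f) := ⟨mk n, fun _ _ => rfl, fun _ _ _ => rfl⟩

theorem rho_mkHom (n : ℕ) (z : (chain f n).Z) : rho f (mkHom f n z) = (chain f n).ρ z := rfl

/-- The image in `K f` of an open box in a stage. -/
def boxMap (n : ℕ) {e : Bool} (B : OpenBox (chain f n).ρ e) : OpenBox (rho f) e :=
  B.map (mkHom f n) (rho_mkHom n)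

theorem boxMap_injective (n : ℕ) {e : Bool} :
    Function.Injective (boxMap n : OpenBox (chain f n).ρ e → OpenBox (rho f) e) :=
  OpenBox.map_injective (mkHom f n) (rho_mkHom n) (mk_injective f n)

/-- A box has finitely many faces, so they all occur in some stage. Allowing every later stage lets
two boxes be compared in a common one. -/
theorem exists_boxMap {e : Bool} (B : OpenBox (rho f) e) :
    ∃ N, ∀ n, N ≤ n → ∃ B₀ : OpenBox (chain f n).ρ e, boxMap n B₀ = B := by
  have hst : ∀ k : K f, ∃ n z, mk n z = k := fun k => by
    induction k using ind with | h n z => exact ⟨n, z, rfl⟩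
  choose st hst using hst
  -- The missing face imposes no bound, hence the default `0`.
  let r : 𝔸 → Bool → ℕ := fun b i => (B.u b i).elim 0 st
  refine ⟨B.A.sup (fun b => max (r b false) (r b true)), fun n hn => ?_⟩
  refine OpenBox.exists_map_eq (mkHom f n) (rho_mkHom n) (mk_injective f n) B (fun b i k hk => ?_)
  have h1 := (Finset.sup_le_iff.1 hn) b (B.mem_A hk)
  have h2 : r b i ≤ n := by
    cases i
    · exact (le_max_left _ _).trans h1
    · exact (le_max_right _ _).trans h1
  have h3 : st k ≤ n := by
    simpa only [r, Option.mem_def.1 hk, Option.elim_some] using h2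
  obtain ⟨z, hz⟩ := hst k
  rw [← hz]
  exact exists_mk_of_le h3 z

theorem exists_fill_of_le {n m : ℕ} (h : n ≤ m) {e : Bool} (B : OpenBox (chain f n).ρ e) :
    ∃ B' : OpenBox (chain f m).ρ e, boxMap m B' = boxMap n B ∧ (fill m B' : K f) = fill n B := by
  induction m, h using Nat.le_induction with
  | base => exact ⟨B, rfl, rfl⟩
  | succ m _ ih =>
    obtain ⟨B', h1, h2⟩ := ih
    refine ⟨B'.map (chain f m).ιHom (chain f m).ρNext_ι, ?_, ?_⟩
    · rw [← h1]
      refine OpenBox.ext rfl rfl ?_ rfl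
      funext b i
      change ((B'.u b i).map (chain f m).ι).map (mk (m + 1)) = (B'.u b i).map (mk m)
      exact (Option.map_map _ _ _).trans
        (congrArg (fun F => Option.map F (B'.u b i)) (funext fun z => mk_ι m z))
    · rw [← h2]
      exact mk_ι (m + 1) (KStep.fill e B' : KStep X (chain f m).ρ)

/-- The element `(u, y)` of `K f` for an `e`-open box `(u, y)` over `K f → Y`. -/
noncomputable def fillBox {e : Bool} (B : OpenBox (rho f) e) : K f :=
  fill _ ((exists_boxMap B).choose_spec _ le_rfl).choose

/-- Independence of the chosen stage: the two representatives of the box become equal in a common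
later stage, and moving there changes neither formal filler. -/
theorem fillBox_boxMap (n : ℕ) {e : Bool} (B : OpenBox (chain f n).ρ e) :
    fillBox (boxMap n B) = fill n B := by
  have h := ((exists_boxMap (boxMap n B)).choose_spec _ le_rfl).choose_spec
  obtain ⟨B₁, h1, h2⟩ := exists_fill_of_le (le_max_left n (exists_boxMap (boxMap n B)).choose) B
  obtain ⟨B₂, h3, h4⟩ := exists_fill_of_le (le_max_right n (exists_boxMap (boxMap n B)).choose)
    ((exists_boxMap (boxMap n B)).choose_spec _ le_rfl).choose
  rw [fillBox, ← h2, ← h4, boxMap_injective _ (h1.trans (h3.trans h).symm)]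

theorem exists_boxMap' {e : Bool} (B : OpenBox (rho f) e) :
    ∃ n, ∃ B₀ : OpenBox (chain f n).ρ e, boxMap n B₀ = B := by
  obtain ⟨n, hn⟩ := exists_boxMap B
  exact ⟨n, hn n le_rfl⟩

theorem boxMap_mem {n : ℕ} {e : Bool} {B : OpenBox (chain f n).ρ e} {b : 𝔸} {i : Bool} {k : K f}
    (hk : k ∈ (boxMap n B).u b i) : ∃ z ∈ B.u b i, mk n z = k :=
  Option.mem_map.1 hk

theorem sub_fillBox_mem {e : Bool} {B : OpenBox (rho f) e} {b : 𝔸} {i : Bool} {k : K f}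
    (hk : k ∈ B.u b i) : sub (fillBox B) b i = k := by
  obtain ⟨n, B, rfl⟩ := exists_boxMap' B
  obtain ⟨z, hz, rfl⟩ := boxMap_mem hk
  rw [fillBox_boxMap, sub_fill_mem n B hz]

theorem fillBox_subst {e : Bool} (B : OpenBox (rho f) e) (c : 𝔸) (i : Bool) (hc : c ∉ B.A) :
    fillBox (B.subst c i hc) = sub (fillBox B) c i := by
  obtain ⟨n, B, rfl⟩ := exists_boxMap' B
  rw [fillBox_boxMap, sub_fill_notMem n B hc, ← fillBox_boxMap]
  exact congrArg fillBox (OpenBox.map_subst _ _ _ _ _ _).symm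

theorem fillBox_smul {e : Bool} (π : FinPerm 𝔸) (B : OpenBox (rho f) e) :
    fillBox (π • B) = π • fillBox B := by
  obtain ⟨n, B, rfl⟩ := exists_boxMap' B
  rw [fillBox_boxMap, smul_fill, ← fillBox_boxMap]
  exact congrArg fillBox (OpenBox.map_smul _ _ _ _).symm

theorem rho_fillBox {e : Bool} (B : OpenBox (rho f) e) : rho f (fillBox B) = B.y := by
  obtain ⟨n, B, rfl⟩ := exists_boxMap' B
  rw [fillBox_boxMap, rho_fill]; rfl

theorem sub_fill_ae (n : ℕ) {e : Bool} (B : OpenBox (chain f n).ρ e) :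
    sub (fill n B : K f) B.a e =
      mk (n + 1) (KStep.comp e (CompBox.mk B) : KStep X (chain f n).ρ) :=
  congrArg (mk (n + 1)) (KStep.fillSub_ae (chain f n).ι)

/-- An open box is determined by its direction and by the composite of its filler. -/
theorem eq_of_sub_fillBox_eq {e : Bool} {B B' : OpenBox (rho f) e} (ha : B.a = B'.a)
    (h : sub (fillBox B) B.a e = sub (fillBox B') B'.a e) : B = B' := by
  obtain ⟨N, hN⟩ := exists_boxMap B
  obtain ⟨N', hN'⟩ := exists_boxMap B'
  obtain ⟨B, rfl⟩ := hN (max N N') (le_max_left _ _)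
  obtain ⟨B', rfl⟩ := hN' (max N N') (le_max_right _ _)
  rw [fillBox_boxMap, fillBox_boxMap] at h
  -- In a common stage both composites are values of the constructor `comp`, so the name
  -- abstractions of the boxes agree.
  have h1 := KStep.comp.inj (mk_injective f _
    ((sub_fill_ae _ B).symm.trans (h.trans (sub_fill_ae _ B'))))
  exact congrArg _ (CompBox.mk_injective (B := B) ha (eq_of_heq h1.2))

theorem mk_base (n : ℕ) (x : X) :
    mk (n + 1) (KStep.base x : KStep X (chain f n).ρ) = lam f x := by
  induction n with
  | zero => rfl
  | succ n ih => exact (mk_ι (n + 1) (KStep.base x : KStep X (chain f n).ρ)).trans ih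

/-- Disjointness of `base` and `comp`, carried to the colimit by injectivity of the stages. -/
theorem lam_ne_sub_fillBox {e : Bool} (x : X) (B : OpenBox (rho f) e) :
    lam f x ≠ sub (fillBox B) B.a e := by
  obtain ⟨n, B, rfl⟩ := exists_boxMap' B
  rw [fillBox_boxMap]
  intro h
  cases mk_injective f _ ((mk_base n x).trans (h.trans (sub_fill_ae n B)))

end K

end Injectivity

/-! ### Pre-normal forms -/

section PreNormalForms

variable {𝔸 : Type v} [DecidableEq 𝔸] [Infinite 𝔸] {X : Type u} {Y : Type w}
    [SubstSet 𝔸 X] [SubstSet 𝔸 Y] {f : SubstHom 𝔸 X Y} {a : 𝔸}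

theorem PreNormal.fillBox (B : OpenBox (K.rho (diag f)) true) (ha : B.a = a)
    (hf : Fresh a B.y.1.1) (h0 : ∀ z ∈ B.u a false, z = K.lam (diag f) B.y.1.1)
    (hs : ∀ b i, b ≠ a → ∀ z ∈ B.u b i, PreNormal f a z) : PreNormal f a (K.fillBox B) := by
  obtain ⟨n, B, rfl⟩ := K.exists_boxMap' B
  have hmem : ∀ {b i z}, z ∈ B.u b i → K.mk n z ∈ (K.boxMap n B).u b i :=
    fun hz => Option.mem_map_of_mem _ hz
  rw [K.fillBox_boxMap]
  exact PreNormal.fill n B ha hf (fun z hz => h0 _ (hmem hz))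
    (fun b i hb z hz => hs b i hb _ (hmem hz))

/-- Inversion without the pre-normality of the sides, which is needed neither for the end points nor
for uniqueness. -/
theorem PreNormal.eq_lam_or_eq_fillBox {k : K (diag f)} (h : PreNormal f a k) :
    (∃ x, Fresh a x ∧ k = K.lam (diag f) x) ∨
      ∃ B : OpenBox (K.rho (diag f)) true, B.a = a ∧ Fresh a B.y.1.1 ∧
        (∀ z ∈ B.u a false, z = K.lam (diag f) B.y.1.1) ∧ k = K.fillBox B := by
  cases h with
  | base x hx => exact Or.inl ⟨x, hx, rfl⟩
  | fill n B ha hf h0 hs =>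
    refine Or.inr ⟨K.boxMap n B, ha, hf, fun z hz => ?_, (K.fillBox_boxMap n B).symm⟩
    obtain ⟨z₀, hz₀, rfl⟩ := K.boxMap_mem hz
    exact h0 z₀ hz₀

theorem PreNormal.fresh_rho_fst {k : K (diag f)} (h : PreNormal f a k) :
    Fresh a (K.rho (diag f) k).1.1 := by
  rcases h.eq_lam_or_eq_fillBox with ⟨x, hx, rfl⟩ | ⟨B, -, hB, -, rfl⟩
  · exact hx
  · rwa [K.rho_fillBox]

theorem PreNormal.sub_false {k : K (diag f)} (h : PreNormal f a k) :
    SubstSet.sub k a false = K.lam (diag f) (K.rho (diag f) k).1.1 := by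
  rcases h.eq_lam_or_eq_fillBox with ⟨x, hx, rfl⟩ | ⟨B, rfl, hB, h0, rfl⟩
  · exact sub_of_fresh _ _ _ (hx.map (K.lam (diag f)).map_smul)
  · rw [K.rho_fillBox]
    obtain ⟨z, hz⟩ := Option.isSome_iff_exists.1 ((B.dom B.a false).2 ⟨B.a_mem, by simp⟩)
    rw [K.sub_fillBox_mem hz, h0 z hz]

/-- A pre-normal form in direction `a` is determined by its normal form. -/
theorem PreNormal.eq_of_sub_true_eq {k k' : K (diag f)} (h : PreNormal f a k)
    (h' : PreNormal f a k') (he : SubstSet.sub k a true = SubstSet.sub k' a true) : k = k' := by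
  have hlam : ∀ x : X, Fresh a x →
      SubstSet.sub (K.lam (diag f) x) a true = K.lam (diag f) x :=
    fun x hx => sub_of_fresh _ _ _ (hx.map (K.lam (diag f)).map_smul)
  -- Elements of `X` are unaffected by `a := 1`, composites determine their box in direction `a`,
  -- and the two mixed cases are impossible.
  rcases h.eq_lam_or_eq_fillBox with ⟨x, hx, rfl⟩ | ⟨B, rfl, -, -, rfl⟩ <;>
  rcases h'.eq_lam_or_eq_fillBox with ⟨x', hx', rfl⟩ | ⟨B', ha', -, -, rfl⟩
  · rwa [hlam x hx, hlam x' hx'] at he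
  · rw [hlam x hx, ← ha'] at he
    exact absurd he (K.lam_ne_sub_fillBox x B')
  · rw [hlam x' hx'] at he
    exact absurd he.symm (K.lam_ne_sub_fillBox x' B)
  · rw [K.eq_of_sub_fillBox_eq (B := B) (B' := B') ha'.symm (by rw [he, ha'])]

/-! ### Recovering a pre-normal form from a normal form -/

namespace PathObj

theorem fresh_val {k : PathObj f} (h : Fresh a k) : Fresh a k.1 :=
  h.map (F := fun k : PathObj f => k.1) (fun _ _ => rfl)

/-- The direction `a'` of a given presentation is fresh for `k`, as is `a`. Swapping them fixes `k`
and turns the presentation into one in direction `a`. -/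
theorem exists_preNormal {k : PathObj f} (h : Fresh a k) :
    ∃ z, PreNormal f a z ∧ sub z a true = k.1 := by
  obtain ⟨a', z, hz, hk⟩ := k.2
  have h1 : Fresh a' k.1 := by rw [hk]; exact fresh_sub _ _ _
  refine ⟨nswap a' a • z, ?_, ?_⟩
  · have := hz.smul (nswap a' a)
    rwa [nswap_left] at this
  · have h2 := perm_sub (nswap a' a) z a' true
    rw [nswap_left, ← hk, nswap_smul h1 (fresh_val h)] at h2
    exact h2.symm

open Classical in
/-- The pre-normal form in direction `a` of a normal form for which `a` is fresh. -/
noncomputable def pre (a : 𝔸) (k : PathObj f) : K (diag f) :=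
  -- The alternative `k.1` is a junk value, never reached when `a` is fresh for `k`.
  if h : ∃ z, PreNormal f a z ∧ sub z a true = k.1 then h.choose else k.1

variable {k : PathObj f}

theorem pre_spec (h : Fresh a k) : PreNormal f a (pre a k) ∧ sub (pre a k) a true = k.1 := by
  rw [pre, dif_pos (exists_preNormal h)]
  exact (exists_preNormal h).choose_spec

theorem preNormal_pre (h : Fresh a k) : PreNormal f a (pre a k) := (pre_spec h).1

theorem sub_pre_true (h : Fresh a k) : sub (pre a k) a true = k.1 := (pre_spec h).2

/-- Uniqueness makes the arbitrary choice canonical: both sides are pre-normal in the same direction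
with the same composite. `sub_pre` rests on the same argument. -/
theorem smul_pre (h : Fresh a k) (π : FinPerm 𝔸) : π • pre a k = pre (π • a) (π • k) := by
  refine ((preNormal_pre h).smul π).eq_of_sub_true_eq (preNormal_pre (h.smul π)) ?_
  rw [sub_pre_true (h.smul π), ← perm_sub, sub_pre_true h]; rfl

theorem sub_pre (h : Fresh a k) {c : 𝔸} (hc : c ≠ a) (j : Bool) :
    sub (pre a k) c j = pre a (sub k c j) := by
  refine ((preNormal_pre h).sub c j hc).eq_of_sub_true_eq (preNormal_pre (h.sub_any c j)) ?_
  rw [sub_pre_true (h.sub_any c j), sub_comm _ _ _ _ _ hc, sub_pre_true h]; rfl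

theorem fresh_pre (h : Fresh a k) {c : 𝔸} (hc : c ≠ a) (hk : Fresh c k) : Fresh c (pre a k) := by
  have := fresh_sub (pre a k) c true
  rwa [sub_pre h hc, sub_of_fresh k c true hk] at this

theorem sub_rho_pre_true (h : Fresh a k) :
    sub (K.rho (diag f) (pre a k)) a true = proj f k := by
  rw [← (K.rho (diag f)).map_sub, sub_pre_true h]; rfl

theorem rho_pre_fst (h : Fresh a k) : (K.rho (diag f) (pre a k)).1.1 = (proj f k).1.1 := by
  rw [← sub_rho_pre_true h]
  exact (sub_of_fresh _ _ _ (preNormal_pre h).fresh_rho_fst).symm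

theorem sub_rho_pre_snd_true (h : Fresh a k) :
    sub (K.rho (diag f) (pre a k)).1.2 a true = (proj f k).1.2 := by
  rw [← sub_rho_pre_true h]; rfl

/-- The face at `a := 0` lies in the copy of `X`, hence over the diagonal, so the underlying path
starts at the first component. -/
theorem sub_rho_pre_snd_false (h : Fresh a k) :
    sub (K.rho (diag f) (pre a k)).1.2 a false = (proj f k).1.1 := by
  have h1 := congrArg (K.rho (diag f)) (preNormal_pre h).sub_false
  rw [(K.rho (diag f)).map_sub, K.rho_lam, rho_pre_fst h] at h1
  exact congrArg (fun y : FibreSquare f => y.1.2) h1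

end PathObj

/-! ### Pre-normal boxes built from their sides -/

/-- The sides of a pre-normal open box in direction `a`: all its faces apart from those in
direction `a`. -/
structure Sides (f : SubstHom 𝔸 X Y) (a : 𝔸) where
  A : Finset 𝔸
  y : FibreSquare f
  s : 𝔸 → Bool → Option (K (diag f))
  notMem : a ∉ A
  fresh_y : Fresh a y.1.1
  sub_y : sub y.1.2 a false = y.1.1
  dom : ∀ b i, (s b i).isSome ↔ b ∈ A
  pre : ∀ b i, ∀ z ∈ s b i, PreNormal f a z
  fresh : ∀ b i, ∀ z ∈ s b i, Fresh b z
  adj : ∀ b i b' i', b ≠ b' → ∀ z ∈ s b i, ∀ z' ∈ s b' i', sub z b' i' = sub z' b i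
  covers : ∀ b i, ∀ z ∈ s b i, K.rho (diag f) z = sub y b i

namespace Sides

theorem mem_A (S : Sides f a) {b i z} (h : z ∈ S.s b i) : b ∈ S.A :=
  (S.dom b i).1 (by rw [Option.mem_def.1 h]; rfl)

/-- This is the adjacency condition between a side and the face `x₁` at `(a, 0)`; it holds
automatically because sides are pre-normal. -/
theorem sub_lam (S : Sides f a) {b i z} (h : z ∈ S.s b i) :
    sub z a false = sub (K.lam (diag f) S.y.1.1) b i := by
  rw [(S.pre b i z h).sub_false, S.covers b i z h]; rfl

/-- The pre-normal open box with given sides. -/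
def toBox (S : Sides f a) : OpenBox (K.rho (diag f)) true where
  A := insert a S.A
  a := a
  u b i := if b = a then (if i then none else some (K.lam (diag f) S.y.1.1)) else S.s b i
  y := S.y
  a_mem := Finset.mem_insert_self _ _
  dom b i := by
    by_cases hb : b = a
    · subst hb
      cases i <;> simp
    · simp [hb, S.dom]
  fresh b i z hz := by
    by_cases hb : b = a
    · subst hb
      cases i
      · rw [if_pos rfl] at hz
        cases hz
        exact S.fresh_y.map (K.lam (diag f)).map_smul
      · simp at hz
    · rw [if_neg hb] at hz
      exact S.fresh b i z hz
  adj b i b' i' hbb z hz z' hz' := by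
    by_cases hb : b = a
    · subst hb
      rw [if_neg hbb.symm] at hz'
      cases i
      · rw [if_pos rfl] at hz
        cases hz
        exact (S.sub_lam hz').symm
      · simp at hz
    · rw [if_neg hb] at hz
      by_cases hb' : b' = a
      · subst hb'
        cases i'
        · rw [if_pos rfl] at hz'
          cases hz'
          exact S.sub_lam hz
        · simp at hz'
      · rw [if_neg hb'] at hz'
        exact S.adj b i b' i' hbb z hz z' hz'
  covers b i z hz := by
    by_cases hb : b = a
    · subst hb
      cases i
      · rw [if_pos rfl] at hz
        cases hz
        rw [K.rho_lam]
        exact Subtype.ext (Prod.ext (sub_of_fresh _ _ _ S.fresh_y).symm S.sub_y.symm)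
      · simp at hz
    · rw [if_neg hb] at hz
      exact S.covers b i z hz

theorem toBox_u_of_ne (S : Sides f a) {b : 𝔸} (hb : b ≠ a) (i : Bool) :
    S.toBox.u b i = S.s b i := if_neg hb

theorem toBox_u_self (S : Sides f a) (i : Bool) :
    S.toBox.u a i = if i then none else some (K.lam (diag f) S.y.1.1) := if_pos rfl

theorem toBox_mem (S : Sides f a) {b i z} (h : z ∈ S.s b i) : z ∈ S.toBox.u b i := by
  rwa [S.toBox_u_of_ne]
  rintro rfl
  exact S.notMem (S.mem_A h)

theorem preNormal (S : Sides f a) : PreNormal f a (K.fillBox S.toBox) := by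
  refine PreNormal.fillBox S.toBox rfl S.fresh_y ?_ ?_
  · intro z hz
    rw [S.toBox_u_self] at hz
    cases hz
    rfl
  · intro b i hb z hz
    rw [S.toBox_u_of_ne hb] at hz
    exact S.pre b i z hz

/-- Only `A`, `y` and `s` enter the box, so agreement of these data suffices. A separate `T` allows
the sides built from a permuted box to be used directly; `subst_toBox` plays the same role for
substitution. -/
theorem smul_toBox (π : FinPerm 𝔸) (S : Sides f a) (T : Sides f (π • a)) (hA : π • S.A = T.A)
    (hy : π • S.y = T.y) (hs : ∀ b i, (S.s b i).map (π • ·) = T.s (π • b) i) :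
    π • S.toBox = T.toBox := by
  refine OpenBox.ext ?_ rfl ?_ hy
  · change π • insert a S.A = insert (π • a) T.A
    rw [Finset.smul_finset_insert, hA]
  · funext b i
    obtain ⟨b, rfl⟩ := MulAction.surjective π b
    rw [OpenBox.smul_u']
    by_cases hb : b = a
    · subst hb
      rw [toBox_u_self, toBox_u_self, ← hy]
      cases i <;> rfl
    · rw [S.toBox_u_of_ne hb, T.toBox_u_of_ne (by simpa using hb), hs]

theorem subst_toBox (S T : Sides f a) (d : 𝔸) (j : Bool) (hd : d ∉ S.toBox.A) (hA : T.A = S.A)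
    (hy : T.y = sub S.y d j) (hs : ∀ b i, T.s b i = (S.s b i).map (sub · d j)) :
    T.toBox = S.toBox.subst d j hd := by
  refine OpenBox.ext ?_ rfl ?_ hy
  · exact congrArg (insert a) hA
  · funext b i
    rw [OpenBox.subst_u]
    by_cases hb : b = a
    · subst hb
      rw [toBox_u_self, toBox_u_self, hy]
      cases i <;> rfl
    · rw [S.toBox_u_of_ne hb, T.toBox_u_of_ne hb, hs]

end Sides

end PreNormalForms

/-! ### Filling open boxes of normal forms -/

namespace PathObj

variable {𝔸 : Type v} [DecidableEq 𝔸] [Infinite 𝔸] {X : Type u} {Y : Type w}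
    [SubstSet 𝔸 X] [SubstSet 𝔸 Y] {f : SubstHom 𝔸 X Y} {e : Bool}

section Fresh

variable {B : OpenBox (proj f) e} {a : 𝔸}

theorem ne_of_mem (h : Fresh a B) {b i k} (hk : k ∈ B.u b i) : b ≠ a := by
  rintro rfl
  exact OpenBox.notMem_of_fresh h (B.mem_A hk)

theorem fresh_of_mem (h : Fresh a B) {b i k} (hk : k ∈ B.u b i) : Fresh a k :=
  (OpenBox.fresh_iff.1 h).2.2 b i k hk

theorem fresh_fst (h : Fresh a B) : Fresh a B.y.1.1 :=
  (OpenBox.fresh_iff.1 h).2.1.map (F := fun y : FibreSquare f => y.1.1) (fun _ _ => rfl)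

theorem fresh_snd (h : Fresh a B) : Fresh a B.y.1.2 :=
  (OpenBox.fresh_iff.1 h).2.1.map (F := fun y : FibreSquare f => y.1.2) (fun _ _ => rfl)

theorem pre_adj (h : Fresh a B) {b i b' i'} (hbb : b ≠ b') {k k'} (hk : k ∈ B.u b i)
    (hk' : k' ∈ B.u b' i') : sub (pre a k) b' i' = sub (pre a k') b i := by
  rw [sub_pre (fresh_of_mem h hk) (ne_of_mem h hk'), sub_pre (fresh_of_mem h hk') (ne_of_mem h hk),
    B.adj b i b' i' hbb k hk k' hk']

end Fresh

/-! ### The box of underlying paths in `X` -/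

variable (B : OpenBox (proj f) e) (a : 𝔸) (h : Fresh a B)

/-- The open box in `X` whose filler is the path underlying the filler of `B`: it consists of the
paths underlying the faces of `B` and of the two end points of `B.y`. -/
noncomputable def pathBox : OpenBox f e where
  A := insert a B.A
  a := B.a
  -- Both faces in the new direction `a` are present, so the only missing face is still the one at
  -- `(B.a, e)`.
  u b i := if b = a then some (if i then B.y.1.2 else B.y.1.1) else
    (B.u b i).map (fun k => (K.rho (diag f) (pre a k)).1.2)
  y := f B.y.1.1
  a_mem := Finset.mem_insert_of_mem B.a_mem
  dom b i := by
    by_cases hb : b = a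
    · subst hb
      have : b ≠ B.a := CompBox.ne_a h
      simp [this]
    · simp [hb, B.dom]
  fresh b i x hx := by
    by_cases hb : b = a
    · subst hb
      rw [if_pos rfl] at hx
      cases hx
      cases i
      · exact fresh_fst h
      · exact fresh_snd h
    · rw [if_neg hb] at hx
      obtain ⟨k, hk, rfl⟩ := Option.mem_map.1 hx
      exact (fresh_pre (fresh_of_mem h hk) hb (B.fresh b i k hk)).map
        (F := fun k => (K.rho (diag f) k).1.2)
        (fun π k => congrArg (fun y : FibreSquare f => y.1.2) ((K.rho (diag f)).map_smul π k))
  adj b i b' i' hbb x hx x' hx' := by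
    -- The path under a face `k` joins the two components of `B.y(b := i)`, which is what adjacency
    -- with the end points requires.
    have key : ∀ b i j, ∀ k ∈ B.u b i, sub (K.rho (diag f) (pre a k)).1.2 a j =
        sub (if j then B.y.1.2 else B.y.1.1) b i := by
      intro b i j k hk
      cases j
      · rw [sub_rho_pre_snd_false (fresh_of_mem h hk), B.covers b i k hk]; rfl
      · rw [sub_rho_pre_snd_true (fresh_of_mem h hk), B.covers b i k hk]; rfl
    by_cases hb : b = a
    · subst hb
      rw [if_pos rfl] at hx
      rw [if_neg hbb.symm] at hx'
      obtain ⟨k, hk, rfl⟩ := Option.mem_map.1 hx'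
      cases hx
      exact (key b' i' i k hk).symm
    · rw [if_neg hb] at hx
      obtain ⟨k, hk, rfl⟩ := Option.mem_map.1 hx
      by_cases hb' : b' = a
      · subst hb'
        rw [if_pos rfl] at hx'
        cases hx'
        exact key b i i' k hk
      · rw [if_neg hb'] at hx'
        obtain ⟨k', hk', rfl⟩ := Option.mem_map.1 hx'
        have h1 := congrArg (fun z => (K.rho (diag f) z).1.2) (pre_adj h hbb hk hk')
        simp only [(K.rho (diag f)).map_sub] at h1
        exact h1
  covers b i x hx := by
    by_cases hb : b = a
    · subst hb
      rw [if_pos rfl] at hx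
      cases hx
      have h1 : f (if i then B.y.1.2 else B.y.1.1) = f B.y.1.1 := by
        cases i
        · rfl
        · exact B.y.2.symm
      rw [h1]
      exact (sub_of_fresh _ _ _ ((fresh_fst h).map f.map_smul)).symm
    · rw [if_neg hb] at hx
      obtain ⟨k, hk, rfl⟩ := Option.mem_map.1 hx
      -- The path has the same image under `f` as its starting point, by definition of the fibre
      -- product.
      rw [← (K.rho (diag f) (pre a k)).2, rho_pre_fst (fresh_of_mem h hk), B.covers b i k hk]
      exact f.map_sub _ _ _

theorem pathBox_u_self (i : Bool) :
    (pathBox B a h).u a i = some (if i then B.y.1.2 else B.y.1.1) := if_pos rfl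

theorem pathBox_u_of_ne {b : 𝔸} (hb : b ≠ a) (i : Bool) :
    (pathBox B a h).u b i = (B.u b i).map (fun k => (K.rho (diag f) (pre a k)).1.2) := if_neg hb

theorem smul_pathBox (π : FinPerm 𝔸) :
    π • pathBox B a h = pathBox (π • B) (π • a) (h.smul π) := by
  refine OpenBox.ext ?_ rfl ?_ (f.map_smul _ _).symm
  · exact Finset.smul_finset_insert _ _ _
  · funext b i
    obtain ⟨b, rfl⟩ := MulAction.surjective π b
    rw [OpenBox.smul_u']
    by_cases hb : b = a
    · subst hb
      rw [pathBox_u_self, pathBox_u_self]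
      cases i <;> rfl
    · rw [pathBox_u_of_ne _ _ _ hb, pathBox_u_of_ne _ _ _ (by simpa using hb), OpenBox.smul_u',
        Option.map_map, Option.map_map]
      refine Option.map_congr (fun k hk => ?_)
      simp only [Function.comp_apply]
      rw [← smul_pre (fresh_of_mem h hk), (K.rho (diag f)).map_smul]; rfl

theorem pathBox_subst (c : 𝔸) (j : Bool) (hc : c ∉ B.A) (hca : c ≠ a)
    (h' : Fresh a (B.subst c j hc)) :
    pathBox (B.subst c j hc) a h' =
      (pathBox B a h).subst c j (by simp [pathBox, hc, hca]) := by
  refine OpenBox.ext rfl rfl ?_ (f.map_sub _ _ _)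
  funext b i
  rw [OpenBox.subst_u]
  by_cases hb : b = a
  · subst hb
    rw [pathBox_u_self, pathBox_u_self]
    cases i <;> rfl
  · rw [pathBox_u_of_ne _ _ _ hb, pathBox_u_of_ne _ _ _ hb, OpenBox.subst_u,
      Option.map_map, Option.map_map]
    refine Option.map_congr (fun k hk => ?_)
    simp only [Function.comp_apply]
    rw [← sub_pre (fresh_of_mem h hk) hca, (K.rho (diag f)).map_sub]; rfl

variable (F : KanFillingOperator f e)

/-- The end point of `B.y` together with the path underlying the filler of `B`. -/
noncomputable def path : FibreSquare f :=
  ⟨(B.y.1.1, F.fill (pathBox B a h)), (F.map_fill (pathBox B a h)).symm⟩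

theorem sub_path_snd (j : Bool) :
    sub (path B a h F).1.2 a j = if j then B.y.1.2 else B.y.1.1 :=
  F.sub_fill (pathBox B a h) a j _ (pathBox_u_self B a h j)

theorem fresh_path_fst : Fresh a (path B a h F).1.1 := fresh_fst h

/-- Lets the `pre a k` serve as sides of a box over `path`: the filler in `X` restricts to the path
underlying each face. -/
theorem rho_pre_eq_sub_path {b i k} (hk : k ∈ B.u b i) :
    K.rho (diag f) (pre a k) = sub (path B a h F) b i := by
  refine Subtype.ext (Prod.ext ?_ ?_)
  · rw [rho_pre_fst (fresh_of_mem h hk), B.covers b i k hk]; rfl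
  · refine (F.sub_fill (pathBox B a h) b i _ ?_).symm
    rw [pathBox_u_of_ne _ _ _ (ne_of_mem h hk)]
    exact Option.mem_map_of_mem (fun k => (K.rho (diag f) (pre a k)).1.2) hk

theorem smul_path (π : FinPerm 𝔸) :
    π • path B a h F = path (π • B) (π • a) (h.smul π) F := by
  refine Subtype.ext (Prod.ext rfl ?_)
  change π • F.fill _ = F.fill _
  rw [← F.fill_smul, smul_pathBox]

theorem path_subst (c : 𝔸) (j : Bool) (hc : c ∉ B.A) (hca : c ≠ a)
    (h' : Fresh a (B.subst c j hc)) :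
    path (B.subst c j hc) a h' F = sub (path B a h F) c j := by
  refine Subtype.ext (Prod.ext rfl ?_)
  change F.fill _ = sub (F.fill _) c j
  rw [← F.fill_subst, pathBox_subst B a h c j hc hca h']

/-! ### The missing side as a formal box -/

/-- The sides of the open box that is the missing face of the pre-normal form of the filler. -/
noncomputable def lidSides : Sides f a where
  -- The missing side must not depend on `B.a`. Its own sides are those of the large box in the
  -- other directions, restricted to `B.a := e`; the face of `B` opposite to the missing one plays
  -- no part.
  A := B.A.erase B.a
  y := sub (path B a h F) B.a e
  s b i := if b = B.a then none else (B.u b i).map (fun k => sub (pre a k) B.a e)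
  notMem hA := OpenBox.notMem_of_fresh h (Finset.mem_of_mem_erase hA)
  fresh_y := (fresh_path_fst B a h F).sub_any _ _
  sub_y := by
    change sub (sub (path B a h F).1.2 B.a e) a false = sub (path B a h F).1.1 B.a e
    rw [sub_comm _ _ _ _ _ (CompBox.ne_a h).symm, sub_path_snd]; rfl
  dom b i := by
    by_cases hb : b = B.a <;> simp [hb, B.dom]
  pre b i z hz := by
    by_cases hb : b = B.a
    · rw [if_pos hb] at hz; cases hz
    rw [if_neg hb] at hz
    obtain ⟨k, hk, rfl⟩ := Option.mem_map.1 hz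
    exact (preNormal_pre (fresh_of_mem h hk)).sub _ _ (CompBox.ne_a h).symm
  fresh b i z hz := by
    by_cases hb : b = B.a
    · rw [if_pos hb] at hz; cases hz
    rw [if_neg hb] at hz
    obtain ⟨k, hk, rfl⟩ := Option.mem_map.1 hz
    exact (fresh_pre (fresh_of_mem h hk) (ne_of_mem h hk) (B.fresh b i k hk)).sub_any _ _
  adj b i b' i' hbb z hz z' hz' := by
    by_cases hb : b = B.a
    · rw [if_pos hb] at hz; cases hz
    by_cases hb' : b' = B.a
    · rw [if_pos hb'] at hz'; cases hz'
    rw [if_neg hb] at hz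
    rw [if_neg hb'] at hz'
    obtain ⟨k, hk, rfl⟩ := Option.mem_map.1 hz
    obtain ⟨k', hk', rfl⟩ := Option.mem_map.1 hz'
    rw [sub_comm _ _ _ _ _ (Ne.symm hb'), pre_adj h hbb hk hk', sub_comm _ _ _ _ _ hb]
  covers b i z hz := by
    by_cases hb : b = B.a
    · rw [if_pos hb] at hz; cases hz
    rw [if_neg hb] at hz
    obtain ⟨k, hk, rfl⟩ := Option.mem_map.1 hz
    rw [(K.rho (diag f)).map_sub, rho_pre_eq_sub_path B a h F hk, sub_comm _ _ _ _ _ hb]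

/-- The missing face of the pre-normal form of the filler. -/
noncomputable def lid : K (diag f) := K.fillBox (lidSides B a h F).toBox

/-- The adjacency of the new side with the given ones. -/
theorem sub_lid {b i k} (hb : b ≠ B.a) (hk : k ∈ B.u b i) :
    sub (lid B a h F) b i = sub (pre a k) B.a e := by
  refine K.sub_fillBox_mem (Sides.toBox_mem _ ?_)
  refine (if_neg hb : (if b = B.a then none else _) = _).trans ?_
  rw [Option.mem_def.1 hk]; rfl

/-- All faces and the base point result from `B.a := e`, and `B.a` was removed from the set of
directions. -/
theorem fresh_lid : Fresh B.a (lid B a h F) := by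
  refine Fresh.map (F := K.fillBox) K.fillBox_smul (OpenBox.fresh_iff.2 ⟨?_, ?_, ?_⟩)
  · simp [Sides.toBox, lidSides, (CompBox.ne_a h).symm]
  · exact fresh_sub _ _ _
  · intro b i z hz
    by_cases hba : b = a
    · subst hba
      rw [Sides.toBox_u_self] at hz
      cases i
      · cases hz
        exact (fresh_sub _ _ _).map (K.lam (diag f)).map_smul
      · cases hz
    · rw [Sides.toBox_u_of_ne _ hba] at hz
      by_cases hb : b = B.a
      · rw [lidSides] at hz
        simp only [if_pos hb] at hz
        cases hz
      rw [lidSides] at hz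
      simp only [if_neg hb] at hz
      obtain ⟨k, hk, rfl⟩ := Option.mem_map.1 hz
      exact fresh_sub _ _ _

theorem smul_lid (π : FinPerm 𝔸) : π • lid B a h F = lid (π • B) (π • a) (h.smul π) F := by
  rw [lid, ← K.fillBox_smul]
  refine congrArg K.fillBox (Sides.smul_toBox _ _ _ ?_ ?_ ?_)
  · exact Finset.image_erase (MulAction.injective π) _ _
  · refine (perm_sub _ _ _ _).trans ?_
    rw [smul_path]; rfl
  · intro b i
    change Option.map _ (if b = B.a then none else _) = if π • b = π • B.a then none else _
    by_cases hb : b = B.a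
    · rw [if_pos hb, if_pos (by rw [hb])]; rfl
    rw [if_neg hb, if_neg (by simpa using hb), OpenBox.smul_u', Option.map_map, Option.map_map]
    refine Option.map_congr (fun k hk => ?_)
    simp only [Function.comp_apply]
    rw [perm_sub, smul_pre (fresh_of_mem h hk)]; rfl

theorem lid_subst (c : 𝔸) (j : Bool) (hc : c ∉ B.A) (hca : c ≠ a)
    (h' : Fresh a (B.subst c j hc)) :
    lid (B.subst c j hc) a h' F = sub (lid B a h F) c j := by
  have hcB : c ≠ B.a := by rintro rfl; exact hc B.a_mem
  have hcA : c ∉ (lidSides B a h F).toBox.A := by simp [Sides.toBox, lidSides, hc, hca]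
  rw [lid, lid, ← K.fillBox_subst _ _ _ hcA]
  refine congrArg K.fillBox (Sides.subst_toBox _ _ _ _ _ rfl ?_ ?_)
  · change sub (path _ a h' F) B.a e = sub (sub (path B a h F) B.a e) c j
    rw [path_subst B a h F c j hc hca h', sub_comm _ _ _ _ _ hcB]
  · intro b i
    change (if b = B.a then none else _) = Option.map _ (if b = B.a then none else _)
    by_cases hb : b = B.a
    · rw [if_pos hb, if_pos hb]; rfl
    rw [if_neg hb, if_neg hb, OpenBox.subst_u, Option.map_map, Option.map_map]
    refine Option.map_congr (fun k hk => ?_)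
    simp only [Function.comp_apply]
    rw [← sub_pre (fresh_of_mem h hk) hca]
    exact sub_comm _ _ _ _ _ hcB

/-! ### The filler and its uniformity -/

/-- The sides of the pre-normal form of the filler. -/
noncomputable def fillSides : Sides f a where
  A := B.A
  y := path B a h F
  -- The gap at `(B.a, e)` is plugged by `lid`, so every direction of `B.A` now has both faces.
  s b i := if b = B.a ∧ i = e then some (lid B a h F) else (B.u b i).map (pre a)
  notMem := OpenBox.notMem_of_fresh h
  fresh_y := fresh_path_fst B a h F
  sub_y := sub_path_snd B a h F false
  dom b i := by
    by_cases hb : b = B.a ∧ i = e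
    · obtain ⟨rfl, rfl⟩ := hb
      simp [B.a_mem]
    · rw [if_neg hb, Option.isSome_map, B.dom]
      simpa using fun _ => not_and.1 hb
  pre b i z hz := by
    by_cases hb : b = B.a ∧ i = e
    · rw [if_pos hb] at hz
      cases hz
      exact (lidSides B a h F).preNormal
    · rw [if_neg hb] at hz
      obtain ⟨k, hk, rfl⟩ := Option.mem_map.1 hz
      exact preNormal_pre (fresh_of_mem h hk)
  fresh b i z hz := by
    by_cases hb : b = B.a ∧ i = e
    · rw [if_pos hb] at hz
      cases hz
      rw [hb.1]
      exact fresh_lid B a h F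
    · rw [if_neg hb] at hz
      obtain ⟨k, hk, rfl⟩ := Option.mem_map.1 hz
      exact fresh_pre (fresh_of_mem h hk) (ne_of_mem h hk) (B.fresh b i k hk)
  adj b i b' i' hbb z hz z' hz' := by
    by_cases hb : b = B.a ∧ i = e
    · rw [if_pos hb] at hz
      cases hz
      obtain ⟨rfl, rfl⟩ := hb
      rw [if_neg (fun H => hbb H.1.symm)] at hz'
      obtain ⟨k, hk, rfl⟩ := Option.mem_map.1 hz'
      exact sub_lid B a h F hbb.symm hk
    · rw [if_neg hb] at hz
      obtain ⟨k, hk, rfl⟩ := Option.mem_map.1 hz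
      by_cases hb' : b' = B.a ∧ i' = e
      · rw [if_pos hb'] at hz'
        cases hz'
        obtain ⟨rfl, rfl⟩ := hb'
        exact (sub_lid B a h F hbb hk).symm
      · rw [if_neg hb'] at hz'
        obtain ⟨k', hk', rfl⟩ := Option.mem_map.1 hz'
        exact pre_adj h hbb hk hk'
  covers b i z hz := by
    by_cases hb : b = B.a ∧ i = e
    · rw [if_pos hb] at hz
      cases hz
      obtain ⟨rfl, rfl⟩ := hb
      exact K.rho_fillBox _
    · rw [if_neg hb] at hz
      obtain ⟨k, hk, rfl⟩ := Option.mem_map.1 hz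
      exact rho_pre_eq_sub_path B a h F hk

/-- The filler of an open box of normal forms, constructed by means of a fresh name `a`. -/
noncomputable def fillAt : PathObj f :=
  ⟨sub (K.fillBox (fillSides B a h F).toBox) a true, a, _, (fillSides B a h F).preNormal, rfl⟩

/-- Since `b ≠ a`, the two substitutions commute: the face of the formal box is `pre a k`, and its
composite is `k`. -/
theorem sub_fillAt (b i) (k) (hk : k ∈ B.u b i) : sub (fillAt B a h F) b i = k := by
  refine Subtype.ext ?_
  change sub (sub (K.fillBox (fillSides B a h F).toBox) a true) b i = k.1
  have hm : pre a k ∈ (fillSides B a h F).s b i := by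
    refine (if_neg (fun H => B.ne_ae hk (Prod.ext H.1 H.2)) :
      (if b = B.a ∧ i = e then some (lid B a h F) else _) = _).trans ?_
    rw [Option.mem_def.1 hk]; rfl
  rw [sub_comm _ _ _ _ _ (ne_of_mem h hk).symm, K.sub_fillBox_mem (Sides.toBox_mem _ hm),
    sub_pre_true (fresh_of_mem h hk)]

theorem proj_fillAt : proj f (fillAt B a h F) = B.y := by
  change K.rho (diag f) (sub (K.fillBox (fillSides B a h F).toBox) a true) = B.y
  rw [(K.rho (diag f)).map_sub, K.rho_fillBox]
  exact Subtype.ext (Prod.ext (sub_of_fresh _ _ _ (fresh_fst h)) (sub_path_snd B a h F true))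

theorem smul_fillAt (π : FinPerm 𝔸) :
    π • fillAt B a h F = fillAt (π • B) (π • a) (h.smul π) F := by
  refine Subtype.ext ((perm_sub _ _ _ _).trans ?_)
  rw [← K.fillBox_smul]
  refine congrArg (fun B => sub (K.fillBox B) (π • a) true) (Sides.smul_toBox _ _ _ rfl ?_ ?_)
  · exact smul_path B a h F π
  · intro b i
    change Option.map _ (if b = B.a ∧ i = e then _ else _) =
      if π • b = π • B.a ∧ i = e then _ else _
    by_cases hb : b = B.a ∧ i = e
    · rw [if_pos hb, if_pos (by rwa [smul_left_cancel_iff])]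
      exact congrArg some (smul_lid B a h F π)
    rw [if_neg hb, if_neg (by rwa [smul_left_cancel_iff]), OpenBox.smul_u', Option.map_map,
      Option.map_map]
    exact Option.map_congr (fun k hk => smul_pre (fresh_of_mem h hk) π)

theorem fillAt_subst (c : 𝔸) (j : Bool) (hc : c ∉ B.A) (hca : c ≠ a)
    (h' : Fresh a (B.subst c j hc)) :
    fillAt (B.subst c j hc) a h' F = sub (fillAt B a h F) c j := by
  refine Subtype.ext (Eq.trans ?_ (sub_comm _ _ _ _ _ hca))
  have hcB : c ≠ B.a := by rintro rfl; exact hc B.a_mem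
  have hcA : c ∉ (fillSides B a h F).toBox.A := by simp [Sides.toBox, fillSides, hc, hca]
  rw [← K.fillBox_subst _ _ _ hcA]
  refine congrArg (fun B => sub (K.fillBox B) a true) (Sides.subst_toBox _ _ _ _ _ rfl ?_ ?_)
  · exact path_subst B a h F c j hc hca h'
  · intro b i
    change (if b = B.a ∧ i = e then _ else _) = Option.map _ (if b = B.a ∧ i = e then _ else _)
    by_cases hb : b = B.a ∧ i = e
    · rw [if_pos hb, if_pos hb]
      exact congrArg some (lid_subst B a h F c j hc hca h')
    rw [if_neg hb, if_neg hb, OpenBox.subst_u, Option.map_map, Option.map_map]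
    exact Option.map_congr (fun k hk => (sub_pre (fresh_of_mem h hk) hca j).symm)

/-! ### Independence of the auxiliary name -/

theorem fillAt_congr {B B' : OpenBox (proj f) e} (hB : B = B') {a a' : 𝔸} (ha : a = a')
    (h : Fresh a B) (h' : Fresh a' B') : fillAt B a h F = fillAt B' a' h' F := by
  subst hB ha; rfl

/-- The name `a` is fresh for the filler, being substituted away, and `a' ≠ a` is fresh by
equivariance. Hence the swap of `a` and `a'` fixes the filler; it also fixes `B`, so it carries the
construction at `a` to the one at `a'`. -/
theorem fillAt_eq {a' : 𝔸} (h' : Fresh a' B) : fillAt B a h F = fillAt B a' h' F := by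
  by_cases haa : a' = a
  · exact fillAt_congr F rfl haa.symm h h'
  have h1 : Fresh a (fillAt B a h F) := Fresh.of_map (F := fun k : PathObj f => k.1)
    (fun _ _ => rfl) Subtype.val_injective (fresh_sub _ _ _)
  have h2 : Fresh a' (fillAt B a h F) := by
    obtain ⟨S, hS, hSB⟩ := h'
    refine ⟨insert a S, by simp [haa, hS], fun π hπ => ?_⟩
    rw [smul_fillAt]
    exact fillAt_congr F (hSB π (fun b hb => hπ (by simp [Finset.mem_coe.1 hb])))
      (hπ (by simp)) _ _
  rw [← nswap_smul h1 h2, smul_fillAt]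
  exact fillAt_congr F (nswap_smul h h') (nswap_left a a') _ _

theorem exists_fresh_box (B : OpenBox (proj f) e) : ∃ a : 𝔸, Fresh a B := by
  obtain ⟨a, -, ha⟩ := exists_fresh (𝔸 := 𝔸) B ∅
  exact ⟨a, ha⟩

/-- A filling operator for `f` gives one for the path object. -/
noncomputable def fillingOperator : KanFillingOperator (proj f) e where
  fill B := fillAt B (exists_fresh_box B).choose (exists_fresh_box B).choose_spec F
  sub_fill B := sub_fillAt B _ _ F
  map_fill B := proj_fillAt B _ _ F
  fill_smul π B := by
    rw [smul_fillAt]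
    exact fillAt_eq _ _ _ _ _
  fill_subst B c i hc := by
    -- The names chosen for `B` and for its substitution may differ, and the one for `B` may be `c`.
    -- Both fillers are recomputed with a single name different from `c`.
    obtain ⟨a, hac, ha⟩ := exists_fresh (𝔸 := 𝔸) B {c}
    have hca : a ≠ c := by simpa using hac
    have ha' : Fresh a (B.subst c i hc) := by
      obtain ⟨hA, hy, hu⟩ := OpenBox.fresh_iff.1 ha
      refine OpenBox.fresh_iff.2 ⟨hA, hy.sub_any _ _, fun b j z hz => ?_⟩
      obtain ⟨k, hk, rfl⟩ := Option.mem_map.1 hz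
      exact (hu b j k hk).sub_any _ _
    rw [fillAt_eq B _ _ F ha, fillAt_eq (B.subst c i hc) _ _ F ha']
    exact fillAt_subst B a ha F c i hc hca.symm ha'

end PathObj

end ZeroOne

open ZeroOne in
/-- For every Kan fibration `f : X → Y` of 01-substitution sets, the restriction of
`ρ_Δ : K Δ → X ×_Y X` to the set `P_Y X` of normal forms is a Kan fibration. -/
theorem mainTheorem7 {𝔸 : Type*} [DecidableEq 𝔸] [Infinite 𝔸] {X Y : Type*}
    [SubstSet 𝔸 X] [SubstSet 𝔸 Y] (f : SubstHom 𝔸 X Y) (hf : IsKanFibration f) :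
    IsKanFibration (PathObj.proj f) :=
  ⟨hf.1.map PathObj.fillingOperator, hf.2.map PathObj.fillingOperator⟩
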